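/- **Setting.** Let $n\ge 1$, let $f:\mathbb R^n\to\mathbb R$, $g=(g_1,\dots,g_{n_g}):\mathbb R^n\to\mathbb R^{n_g}$ and $h=(h_1,\dots,h_{n_h}):\mathbb R^n\to\mathbb R^{n_h}$ be continuously differentiable with Lipschitz continuous gradients, let $f(x)\to\infty$ as $|x|\to\infty$, and let $C=\{x: g(x)\ge 0,\ h(x)=0\}$ be nonempty and bounded. For $x\in\mathbb R^n$ let $I_x=\{i: g_i(x)\le 0\}$. Assume that the Mangasarian–Fromovitz constraint qualification holds at every $x\in\mathbb R^n$: the vectors $\nabla h_j(x)$ are linearly independent and there is $w\in\mathbb R^n$ with $\nabla h(x)^{\top}w=0$ and $\nabla g_i(x)^{\top}w>0$ for all $i\in I_x$. Assume moreover that $f$ is strongly convex with constant $\mu>0$, that every $g_i$ is concave, and that every $h_j$ is affine (so that $C$ is convex). Let $x^*$ be the minimizer of $f$ over $C$. For $\alpha>0$ let $$V_\alpha(x)=\{v\in\mathbb R^n:\ \nabla h(x)^{\top}v+\alpha h(x)=0,\ \ \nabla g_i(x)^{\top}v+\alpha g_i(x)\ge 0\ \ \forall i\in I_x\},\qquad v(x)=\operatorname*{argmin}_{v\in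 V_\alpha(x)}\tfrac12|v+\nabla f(x)|^2 .$$ Let $l(x,\lambda)=f(x)-\lambda^{\top}(h(x),g(x))$, let $D_x$ be the set of $\lambda\in\mathbb R^{n_h}\times\mathbb R^{n_g}_{\ge 0}$ with $\lambda_{n_h+i}=0$ for all $i\notin I_x$, and for every $x$ let $\lambda(x)$ be any maximizer of $l(x,\lambda)-\frac1{2\alpha}|\nabla_x l(x,\lambda)|^2$ over $\lambda\in D_x$. Let $\bar L_l(\lambda)$ be the smoothness constant of $l(\cdot,\lambda)$, i.e. the least Lipschitz constant of $\nabla_x l(\cdot,\lambda)$. Constrained gradient descent with step size $T>0$ is $$x_{k+1}=x_k-T\nabla f(x_k)+TR_k,\qquad -R_k\in\partial\psi_{V_\alpha(x_k)}\big((x_{k+1}-x_k)/T\big),\qquad k=0,1,2,\dots,$$ where $\psi_S$ is $0$ on $S$ and $+\infty$ elsewhere, and $\partial$ is the subdifferential. **Proposition.** Let $0<\alpha<\mu$, let $L_l\ge\bar L_l(\lambda(x))$ for all $x\in\mathbb R^n$, and let $0<T\le 2/(L_l+\mu)$. Then for every $x_0\in\mathbb R^n$ the iterates $x_k$ are well defined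 and unique, and there are an integer $N>0$ and a constant $c_3>0$ such that $$\tfrac12|v(x_{k+1})|^2\le\big(1-2\mu T(1-\mu T/2)\big)\,\tfrac12|v(x_k)|^2+c_3(1-\alpha T)^{k-N}\qquad\forall k\ge N .$$ In particular, if $T=1/L_l$ and $\alpha=\mu/2$, there is a constant $c_4$ such that $$|x_k-x^*|^2\le c_4\,\big(1-\mu/(2L_l)\big)^k\qquad\forall k\ge N$$ (with the same $N$), i.e. the rate scales with $\mu/L_l$. -/

import Mathlib

noncomputable section

/-- The data of the constrained problem: minimize `f x` over all `x` in `ℝⁿ` with `g i x ≥ 0` for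
all `i` and `h j x = 0` for all `j`. -/
structure ConstrainedProblem (n ng nh : ℕ) where
  f : EuclideanSpace ℝ (Fin n) → ℝ
  g : Fin ng → EuclideanSpace ℝ (Fin n) → ℝ
  h : Fin nh → EuclideanSpace ℝ (Fin n) → ℝ

/-- Continuously differentiable with a (globally) Lipschitz continuous gradient. -/
def IsC1LipschitzGradient {n : ℕ} (φ : EuclideanSpace ℝ (Fin n) → ℝ) : Prop :=
  ContDiff ℝ 1 φ ∧ ∃ K : NNReal, LipschitzWith K (gradient φ)

/-- The smoothness constant of `φ`: the least Lipschitz constant of its gradient. -/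
def smoothnessConstant {n : ℕ} (φ : EuclideanSpace ℝ (Fin n) → ℝ) : ℝ :=
  sInf {K : ℝ | 0 ≤ K ∧ ∀ y z, ‖gradient φ y - gradient φ z‖ ≤ K * ‖y - z‖}

open Classical in
/-- The convex-analytic indicator function of a set: `0` on the set and `∞` outside. -/
def convexIndicator {n : ℕ} (S : Set (EuclideanSpace ℝ (Fin n))) :
    EuclideanSpace ℝ (Fin n) → EReal :=
  fun x => if x ∈ S then 0 else ⊤

/-- The subdifferential of an extended real valued function. In `EReal`, `⊤ - ⊤ = ⊥`, so that it is
empty at every point where the function takes the value `⊤`. -/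
def subdifferential {n : ℕ} (φ : EuclideanSpace ℝ (Fin n) → EReal)
    (x : EuclideanSpace ℝ (Fin n)) : Set (EuclideanSpace ℝ (Fin n)) :=
  {p | ∀ y, ((inner ℝ p (y - x) : ℝ) : EReal) ≤ φ y - φ x}

namespace ConstrainedProblem

variable {n ng nh : ℕ} (P : ConstrainedProblem n ng nh)

/-- The feasible set `C`. -/
def feasibleSet : Set (EuclideanSpace ℝ (Fin n)) :=
  {x | (∀ i, 0 ≤ P.g i x) ∧ ∀ j, P.h j x = 0}

/-- `xs` is a minimizer of the constrained problem. -/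
def IsMinimizer (xs : EuclideanSpace ℝ (Fin n)) : Prop :=
  xs ∈ P.feasibleSet ∧ IsMinOn P.f P.feasibleSet xs

/-- The indices of the active (that is, closed or violated) inequality constraints at `x`. -/
def active (x : EuclideanSpace ℝ (Fin n)) : Set (Fin ng) :=
  {i | P.g i x ≤ 0}

/-- The Mangasarian-Fromovitz constraint qualification at `x`. -/
def MFCQ (x : EuclideanSpace ℝ (Fin n)) : Prop :=
  LinearIndependent ℝ (fun j => gradient (P.h j) x) ∧
    ∃ w : EuclideanSpace ℝ (Fin n),
      (∀ j, inner ℝ (gradient (P.h j) x) w = 0) ∧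
      ∀ i ∈ P.active x, 0 < inner ℝ (gradient (P.g i) x) w

/-- The standing assumptions on the problem. -/
structure Standing : Prop where
  smooth_f : IsC1LipschitzGradient P.f
  smooth_g : ∀ i, IsC1LipschitzGradient (P.g i)
  smooth_h : ∀ j, IsC1LipschitzGradient (P.h j)
  coercive : Filter.Tendsto P.f (Filter.cocompact (EuclideanSpace ℝ (Fin n))) Filter.atTop
  feasible_nonempty : P.feasibleSet.Nonempty
  feasible_bounded : Bornology.IsBounded P.feasibleSet
  mfcq : ∀ x, P.MFCQ x

/-- The convexity assumption: `f` is strongly convex with constant `μ > 0`, and the feasible set is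
described by concave functions `g i` and affine functions `h j`. -/
structure Convexity (μ : ℝ) : Prop where
  mu_pos : 0 < μ
  strongConvex_f : StrongConvexOn Set.univ μ P.f
  concave_g : ∀ i, ConcaveOn ℝ Set.univ (P.g i)
  affine_h : ∀ j, ∃ A : EuclideanSpace ℝ (Fin n) →ᵃ[ℝ] ℝ, ∀ x, P.h j x = A x

/-- The set `V_α(x)` of admissible velocities at `x`. -/
def admissible (α : ℝ) (x : EuclideanSpace ℝ (Fin n)) : Set (EuclideanSpace ℝ (Fin n)) :=
  {v | (∀ j, inner ℝ (gradient (P.h j) x) v + α * P.h j x = 0) ∧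
    ∀ i ∈ P.active x, 0 ≤ inner ℝ (gradient (P.g i) x) v + α * P.g i x}

/-- The velocity `v(x)`: the (unique) minimizer of `½ |v + ∇f(x)|²` over `v ∈ V_α(x)`. It exists
because `V_α(x)` is closed, convex and, under the constraint qualification, nonempty. -/
def velocity (α : ℝ) (x : EuclideanSpace ℝ (Fin n)) : EuclideanSpace ℝ (Fin n) :=
  Classical.epsilon fun v =>
    v ∈ P.admissible α x ∧
      IsMinOn (fun u => (1 / 2 : ℝ) * ‖u + gradient P.f x‖ ^ 2) (P.admissible α x) v

/-- The Lagrangian `l(x, lam) = f(x) - lamᵀ (h(x), g(x))`. -/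
def lagrangian (lam : (Fin nh → ℝ) × (Fin ng → ℝ)) (x : EuclideanSpace ℝ (Fin n)) : ℝ :=
  P.f x - ((∑ j, lam.1 j * P.h j x) + ∑ i, lam.2 i * P.g i x)

/-- The set `D_x` of multipliers: free for equality constraints, nonnegative for inequality
constraints, and zero for the inactive inequality constraints. -/
def multipliers (x : EuclideanSpace ℝ (Fin n)) : Set ((Fin nh → ℝ) × (Fin ng → ℝ)) :=
  {lam | (∀ i, 0 ≤ lam.2 i) ∧ ∀ i, i ∉ P.active x → lam.2 i = 0}

/-- The objective of the dual of the problem that defines the velocity,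
`l(x, lam) - |∇ₓ l(x, lam)|² / (2 α)`. -/
def dualObjective (α : ℝ) (x : EuclideanSpace ℝ (Fin n))
    (lam : (Fin nh → ℝ) × (Fin ng → ℝ)) : ℝ :=
  P.lagrangian lam x - 1 / (2 * α) * ‖gradient (P.lagrangian lam) x‖ ^ 2

/-- `lam` attains the maximum of the dual objective over `D_x`. -/
def IsDualSolution (α : ℝ) (x : EuclideanSpace ℝ (Fin n))
    (lam : (Fin nh → ℝ) × (Fin ng → ℝ)) : Prop :=
  lam ∈ P.multipliers x ∧ IsMaxOn (P.dualObjective α x) (P.multipliers x) lam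

/-- `x` is a sequence of iterates of constrained gradient descent with step size `T`:
`x_{k+1} = x_k - T ∇f(x_k) + T R_k` with `-R_k ∈ ∂ψ_{V_α(x_k)}((x_{k+1} - x_k) / T)`. -/
def IsIterates (α T : ℝ) (x : ℕ → EuclideanSpace ℝ (Fin n)) : Prop :=
  ∃ R : ℕ → EuclideanSpace ℝ (Fin n), ∀ k,
    x (k + 1) = x k - T • gradient P.f (x k) + T • R k ∧
    -R k ∈ subdifferential (convexIndicator (P.admissible α (x k))) (T⁻¹ • (x (k + 1) - x k))

end ConstrainedProblem

end

/-! Optimality of the multiplier `lam k` at `x k` identifies the velocity as `-∇ₓ l(x k, lam k)`, so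
each iteration is a plain gradient step on the Lagrangian with that multiplier frozen. This function
is `μ`-strongly convex and `Ll`-smooth, hence the step contracts by `1 - μT`; the whole difficulty
is that the multiplier changes along the way.

Convergence. Concavity keeps every constraint with positive multiplier active at the next iterate,
so `lam k` is a competitor in the dual problem at `x (k + 1)`. Hence the optimal dual value grows by
a multiple of `|v|²`, positive because `α < μ`. Weak duality bounds it by `f` on the feasible set,
so `v → 0`, and every limit point of the bounded iterates is the minimizer `xs`.

Rate. Put `β = 1 - αT`, `r k = |x k - xs|²`, `φ k = -⟨∇f(xs), x k - xs⟩`. By a Hoffman-type bound at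
`xs` (`exists_nonneg_solution_near`, where MFCQ enters), `lam k` is eventually close to an exact
multiplier `lam'` of `xs` with `lam' ≤ (1 + η k) lam k` in the inequality entries and `η k = O(√(r
k) + √(r (k+1)))`. Contraction about `xs` then gives `r (k+1) ≤ (1 - μT)² r k + 2T η k (φ (k+1) +
O(β^(k+1)) + O(r (k+1)))`, while the velocity constraints give `φ (k+1) ≤ β φ k + O(r k + r (k+1))`.
Since `(1 - μT)² < β`, a weighted sum `U` obeys `U (k+1) ≤ β U k + O(√(U k) + √(U (k+1))) U (k+1)`.
Such a sequence first decays at some geometric rate, so its perturbations are summable, and the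
exact rate `β` is recovered. Thus `r` and `|v|²` are `O(β^k)`, which yields both claims. -/

open Filter Topology

/-! ### Convexity and smoothness inequalities for gradients; contraction of a gradient step. -/

section Gradient

theorem norm_sq_sub_norm_sq_sub_two_inner {E : Type*} [NormedAddCommGroup E]
    [InnerProductSpace ℝ E] (x y : E) :
    ‖y‖ ^ 2 - ‖x‖ ^ 2 - 2 * inner ℝ x (y - x) = ‖y - x‖ ^ 2 := by
  rw [norm_sub_sq_real, inner_sub_right, real_inner_self_eq_norm_sq, real_inner_comm]
  ring

variable {E : Type*} [NormedAddCommGroup E] [InnerProductSpace ℝ E] [CompleteSpace E]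

theorem HasGradientAt.hasDerivAt_line {φ : E → ℝ} {G : E} {x d : E} {t : ℝ}
    (h : HasGradientAt φ G (x + t • d)) :
    HasDerivAt (fun s : ℝ => φ (x + s • d)) (inner ℝ G d) t := by
  have h1 : HasDerivAt (fun s : ℝ => x + s • d) d t := by
    simpa using ((hasDerivAt_id t).smul_const d).const_add x
  have h2 := h.hasFDerivAt.comp_hasDerivAt t h1
  exact h2

theorem ConvexOn.add_inner_gradient_le {φ : E → ℝ} (hφ : ConvexOn ℝ Set.univ φ)
    (hd : Differentiable ℝ φ) (x y : E) :
    φ x + inner ℝ (gradient φ x) (y - x) ≤ φ y := by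
  have hc : ConvexOn ℝ Set.univ (fun s : ℝ => φ (x + s • (y - x))) := by
    have := hφ.comp_affineMap (AffineMap.lineMap x y : ℝ →ᵃ[ℝ] E)
    simpa [Function.comp_def, AffineMap.lineMap_apply, add_comm] using this
  have hder : HasDerivAt (fun s : ℝ => φ (x + s • (y - x))) (inner ℝ (gradient φ x) (y - x)) 0 := by
    apply HasGradientAt.hasDerivAt_line
    simpa using (hd x).hasGradientAt
  have := hc.le_slope_of_hasDerivAt (Set.mem_univ 0) (Set.mem_univ 1) one_pos hder
  rw [slope_def_field] at this
  norm_num [-inner_gradient_left] at this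
  linarith

theorem gradient_neg' {φ : E → ℝ} (hd : Differentiable ℝ φ) (x : E) :
    gradient (-φ) x = -gradient φ x :=
  (hasGradientAt_iff_hasFDerivAt.2 (by
    simpa using (hd x).hasGradientAt.hasFDerivAt.neg)).gradient

theorem ConcaveOn.le_add_inner_gradient {φ : E → ℝ} (hφ : ConcaveOn ℝ Set.univ φ)
    (hd : Differentiable ℝ φ) (x y : E) :
    φ y ≤ φ x + inner ℝ (gradient φ x) (y - x) := by
  have h := hφ.neg.add_inner_gradient_le hd.neg x y
  rw [gradient_neg' hd, inner_neg_left] at h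
  simp only [Pi.neg_apply] at h
  linarith

theorem hasGradientAt_half_sq_norm (c : ℝ) (x : E) :
    HasGradientAt (fun z : E => c / 2 * ‖z‖ ^ 2) (c • x) x := by
  rw [hasGradientAt_iff_hasFDerivAt]
  have := ((hasStrictFDerivAt_norm_sq x).hasFDerivAt).const_mul (c / 2)
  have hL : InnerProductSpace.toDual ℝ E (c • x) = (c / 2) • 2 • (innerSL ℝ) x := by
    ext d
    simp
    ring
  rw [hL]
  exact this

theorem HasGradientAt.sub' {φ ψ : E → ℝ} {G H x : E} (h : HasGradientAt φ G x)
    (h' : HasGradientAt ψ H x) : HasGradientAt (fun z => φ z - ψ z) (G - H) x := by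
  rw [hasGradientAt_iff_hasFDerivAt] at *
  rw [map_sub]
  exact h.sub h'

theorem StrongConvexOn.add_inner_gradient_le {φ : E → ℝ} {μ : ℝ}
    (hφ : StrongConvexOn Set.univ μ φ) (hd : Differentiable ℝ φ) (x y : E) :
    φ x + inner ℝ (gradient φ x) (y - x) + μ / 2 * ‖y - x‖ ^ 2 ≤ φ y := by
  have hc := strongConvexOn_iff_convex.1 hφ
  have hg : ∀ z, HasGradientAt (fun z => φ z - μ / 2 * ‖z‖ ^ 2) (gradient φ z - μ • z) z :=
    fun z => (hd z).hasGradientAt.sub' (hasGradientAt_half_sq_norm μ z)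
  have h := hc.add_inner_gradient_le (fun z => (hg z).differentiableAt) x y
  rw [(hg x).gradient, inner_sub_left, inner_smul_left] at h
  have := norm_sq_sub_norm_sq_sub_two_inner x y
  simp only [conj_trivial] at h
  rw [← this]
  linarith

theorem le_add_inner_gradient_of_lipschitz {φ : E → ℝ} {K : ℝ} (hd : Differentiable ℝ φ)
    (hK : ∀ y z, ‖gradient φ y - gradient φ z‖ ≤ K * ‖y - z‖) (x y : E) :
    φ y ≤ φ x + inner ℝ (gradient φ x) (y - x) + K / 2 * ‖y - x‖ ^ 2 := by
  set d := y - x with hdd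
  have hder : ∀ t : ℝ, HasDerivAt
      (fun s : ℝ => φ (x + s • d) - s * inner ℝ (gradient φ x) d - K / 2 * ‖d‖ ^ 2 * s ^ 2)
      (inner ℝ (gradient φ (x + t • d)) d - inner ℝ (gradient φ x) d - K * ‖d‖ ^ 2 * t) t := by
    intro t
    have h1 := ((hd (x + t • d)).hasGradientAt).hasDerivAt_line
    have h2 := (hasDerivAt_id t).mul_const (inner ℝ (gradient φ x) d)
    have h3 := ((hasDerivAt_id t).pow 2).const_mul (K / 2 * ‖d‖ ^ 2)
    refine ((h1.sub h2).sub h3).congr_deriv ?_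
    norm_num
    ring
  have hanti : AntitoneOn
      (fun s : ℝ => φ (x + s • d) - s * inner ℝ (gradient φ x) d - K / 2 * ‖d‖ ^ 2 * s ^ 2)
      (Set.Icc 0 1) := by
    apply antitoneOn_of_deriv_nonpos (convex_Icc 0 1)
    · exact fun t _ => (hder t).continuousAt.continuousWithinAt
    · exact fun t _ => (hder t).differentiableAt.differentiableWithinAt
    · intro t ht
      rw [interior_Icc] at ht
      rw [(hder t).deriv, ← inner_sub_left]
      have h1 := real_inner_le_norm (gradient φ (x + t • d) - gradient φ x) d
      have h2 := hK (x + t • d) x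
      rw [add_sub_cancel_left, norm_smul, Real.norm_of_nonneg ht.1.le] at h2
      nlinarith [norm_nonneg d, mul_le_mul_of_nonneg_right h2 (norm_nonneg d)]
  have := hanti (by simp : (0:ℝ) ∈ Set.Icc (0:ℝ) 1) (by simp : (1:ℝ) ∈ Set.Icc (0:ℝ) 1) zero_le_one
  have hy : x + d = y := by rw [hdd]; abel
  norm_num [hy, -inner_gradient_left] at this
  linarith

theorem add_inner_gradient_sub_le_of_lipschitz {φ : E → ℝ} {K : ℝ} (hd : Differentiable ℝ φ)
    (hK : ∀ y z, ‖gradient φ y - gradient φ z‖ ≤ K * ‖y - z‖) (x y : E) :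
    φ x + inner ℝ (gradient φ x) (y - x) - K / 2 * ‖y - x‖ ^ 2 ≤ φ y := by
  have h := le_add_inner_gradient_of_lipschitz hd.neg (K := K) (fun y z => by
    rw [gradient_neg' hd, gradient_neg' hd, ← neg_sub', norm_neg]
    exact hK y z) x y
  rw [gradient_neg' hd, inner_neg_left] at h
  simp only [Pi.neg_apply] at h
  linarith

/-- Cocoercivity of the gradient. The usual choice is `t = 1 / K`; leaving `t` free avoids dividing
by a `K` that may vanish. -/
theorem inner_gradient_sub_ge {ψ : E → ℝ} {K : ℝ}
    (hc : ∀ x y, ψ x + inner ℝ (gradient ψ x) (y - x) ≤ ψ y)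
    (hs : ∀ x y, ψ y ≤ ψ x + inner ℝ (gradient ψ x) (y - x) + K / 2 * ‖y - x‖ ^ 2)
    (t : ℝ) (x y : E) :
    (2 * t - K * t ^ 2) * ‖gradient ψ x - gradient ψ y‖ ^ 2 ≤
      inner ℝ (gradient ψ x - gradient ψ y) (x - y) := by
  have key : ∀ x y : E, (t - K * t ^ 2 / 2) * ‖gradient ψ x - gradient ψ y‖ ^ 2 ≤
      ψ y - ψ x - inner ℝ (gradient ψ x) (y - x) := by
    intro x y
    set D := gradient ψ y - gradient ψ x with hD
    -- The value at `y - t • D` is bounded below by the tangent at `x` and above by the quadratic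
    -- model at `y`.
    have h1 := hc x (y - t • D)
    have h2 := hs y (y - t • D)
    have h3 : y - t • D - y = -(t • D) := by abel
    have h4 : y - t • D - x = (y - x) - t • D := by abel
    have h5 : ‖D‖ ^ 2 = inner ℝ (gradient ψ y) D - inner ℝ (gradient ψ x) D := by
      rw [← inner_sub_left, ← hD, real_inner_self_eq_norm_sq]
    rw [h3, norm_neg, norm_smul, mul_pow, Real.norm_eq_abs, sq_abs, inner_neg_right,
      inner_smul_right] at h2
    rw [h4, inner_sub_right, inner_smul_right] at h1
    rw [norm_sub_rev, ← hD]
    have h6 : t * ‖D‖ ^ 2 = t * inner ℝ (gradient ψ y) D - t * inner ℝ (gradient ψ x) D := by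
      rw [h5]; ring
    linarith
  have h1 := key x y
  have h2 := key y x
  have h3 : inner ℝ (gradient ψ x - gradient ψ y) (x - y) =
      -inner ℝ (gradient ψ x) (y - x) - inner ℝ (gradient ψ y) (x - y) := by
    rw [inner_sub_left, ← neg_sub y x, inner_neg_right, inner_neg_right]
  rw [norm_sub_rev (gradient ψ y)] at h2
  rw [h3]
  linarith

/-- The gradient step of a strongly convex function with Lipschitz gradient is a contraction. -/
theorem StrongConvexOn.norm_gradient_step_sub_le {φ : E → ℝ} {μ K T : ℝ}
    (hφ : StrongConvexOn Set.univ μ φ) (hd : Differentiable ℝ φ)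
    (hK : ∀ y z, ‖gradient φ y - gradient φ z‖ ≤ K * ‖y - z‖)
    (hμK : μ ≤ K) (hT : 0 < T) (hTK : T * (K + μ) ≤ 2) (x y : E) :
    ‖x - y - T • (gradient φ x - gradient φ y)‖ ≤ (1 - μ * T) * ‖x - y‖ := by
  have hg : ∀ z, HasGradientAt (fun z => φ z - μ / 2 * ‖z‖ ^ 2) (gradient φ z - μ • z) z :=
    fun z => (hd z).hasGradientAt.sub' (hasGradientAt_half_sq_norm μ z)
  have hgr : ∀ z, gradient (fun z => φ z - μ / 2 * ‖z‖ ^ 2) z = gradient φ z - μ • z :=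
    fun z => (hg z).gradient
  have hco := fun t => inner_gradient_sub_ge (ψ := fun z => φ z - μ / 2 * ‖z‖ ^ 2) (K := K - μ)
    (fun x y => (strongConvexOn_iff_convex.1 hφ).add_inner_gradient_le
      (fun z => (hg z).differentiableAt) x y)
    (fun x y => by
      rw [hgr, inner_sub_left, inner_smul_left]
      have h1 := le_add_inner_gradient_of_lipschitz hd hK x y
      have h2 := norm_sq_sub_norm_sq_sub_two_inner x y
      simp only [conj_trivial]
      rw [← h2] at h1 ⊢
      linarith) t x y
  simp only [hgr] at hco
  set e := x - y with he
  set D := gradient φ x - μ • x - (gradient φ y - μ • y) with hD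
  have hDe : gradient φ x - gradient φ y = D + μ • e := by
    rw [hD, he, smul_sub]; abel
  have hμT : μ * T ≤ 1 := by nlinarith
  have hkey : T * ‖D‖ ^ 2 ≤ 2 * (1 - μ * T) * inner ℝ D e := by
    -- In the extreme case `μT = 1` the step bound forces `K = μ`, and letting `t` be large in
    -- cocoercivity gives `D = 0`. Otherwise `t = T / (2(1 - μT))` is admissible.
    rcases hμT.eq_or_lt with h1 | h1
    · have hD0 : ‖D‖ ^ 2 = 0 := by
        by_contra hne
        have hpos : 0 < ‖D‖ ^ 2 := lt_of_le_of_ne (sq_nonneg _) (Ne.symm hne)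
        have hKμ : K - μ ≤ 0 := by nlinarith
        have h2 := hco ((|inner ℝ D e| + 1) / ‖D‖ ^ 2)
        set t := (|inner ℝ D e| + 1) / ‖D‖ ^ 2 with ht
        have ht' : t * ‖D‖ ^ 2 = |inner ℝ D e| + 1 := div_mul_cancel₀ _ hne
        have h3 : 0 ≤ -(K - μ) * t ^ 2 * ‖D‖ ^ 2 :=
          mul_nonneg (mul_nonneg (by linarith) (sq_nonneg _)) (sq_nonneg _)
        have h4 := le_abs_self (inner ℝ D e)
        have h5 := abs_nonneg (inner ℝ D e)
        nlinarith
      rw [h1, hD0]; simp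
    · have hpos : 0 < 2 * (1 - μ * T) := by linarith
      have h2 := hco (T / (2 * (1 - μ * T)))
      set t := T / (2 * (1 - μ * T)) with ht
      have htpos : 0 < t := div_pos hT hpos
      have ht' : 2 * (1 - μ * T) * t = T := mul_div_cancel₀ _ hpos.ne'
      have h3 : (K - μ) * t ≤ 1 := by
        rw [ht, ← mul_div_assoc, div_le_one hpos]; nlinarith
      have h4 : t ≤ 2 * t - (K - μ) * t ^ 2 := by nlinarith
      have h5 := (mul_le_mul_of_nonneg_right h4 (sq_nonneg ‖D‖)).trans h2
      calc T * ‖D‖ ^ 2 = 2 * (1 - μ * T) * (t * ‖D‖ ^ 2) := by rw [← mul_assoc, ht']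
        _ ≤ _ := mul_le_mul_of_nonneg_left h5 hpos.le
  have hrw : e - T • (gradient φ x - gradient φ y) = (1 - μ * T) • e - T • D := by
    rw [hDe, smul_add, sub_smul, one_smul, smul_smul, mul_comm T μ]; abel
  rw [hrw]
  apply le_of_sq_le_sq _ (mul_nonneg (by linarith) (norm_nonneg _))
  rw [norm_sub_sq_real, norm_smul, norm_smul, inner_smul_left, inner_smul_right, mul_pow, mul_pow,
    Real.norm_eq_abs, Real.norm_eq_abs, sq_abs, sq_abs, real_inner_comm]
  simp only [conj_trivial]
  nlinarith [mul_le_mul_of_nonneg_left hkey hT.le]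

end Gradient

/-! ### Hoffman-type error bound for nonnegative solutions of linear systems. -/

section Polyhedral

theorem exists_pos_forall_le {ι : Type*} [Finite ι] {u : ι → ℝ} :
    ∃ m : ℝ, 0 < m ∧ ∀ i, 0 < u i → m ≤ u i := by
  have h : ∀ᶠ m : ℝ in 𝓝[>] 0, ∀ i, 0 < u i → m ≤ u i := by
    rw [eventually_all]
    intro i
    by_cases hi : 0 < u i
    · filter_upwards [Ioo_mem_nhdsGT hi] with m hm _ using hm.2.le
    · exact Eventually.of_forall fun m h => absurd h hi
  obtain ⟨m, hm, hm0⟩ := (h.and self_mem_nhdsWithin).exists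
  exact ⟨m, hm0, hm⟩

/-- Moving from a nonnegative vector in a direction with a negative entry, one reaches a point
where an entry vanishes while all remain nonnegative. -/
theorem exists_add_smul_nonneg_eq_zero {ι : Type*} {S : Finset ι} {a d : ι → ℝ}
    (ha : ∀ i, 0 ≤ a i) (hd : ∀ i ∉ S, d i = 0) (hneg : ∃ i, d i < 0) :
    ∃ t : ℝ, 0 ≤ t ∧ (∀ i, 0 ≤ a i + t * d i) ∧ ∃ i ∈ S, a i + t * d i = 0 := by
  classical
  obtain ⟨i₀, hi₀⟩ := hneg
  have hmem : ∀ i, d i < 0 → i ∈ S := fun i hi => by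
    by_contra h
    exact hi.ne (hd i h)
  obtain ⟨i, hi, hmin⟩ := (S.filter fun i => d i < 0).exists_min_image (fun i => a i / (-d i))
    ⟨i₀, by simp [hi₀, hmem i₀ hi₀]⟩
  rw [Finset.mem_filter] at hi
  have hdi : 0 < -d i := by linarith [hi.2]
  refine ⟨a i / (-d i), div_nonneg (ha i) hdi.le, fun j => ?_, i, hi.1, ?_⟩
  · by_cases hj : d j < 0
    · have h1 := hmin j (by simp [hj, hmem j hj])
      have h2 : 0 < -d j := by linarith
      rw [le_div_iff₀ h2] at h1
      linarith
    · have := mul_nonneg (div_nonneg (ha i) hdi.le) (not_lt.1 hj)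
      linarith [ha j]
  · have := div_mul_cancel₀ (a i) hdi.ne'
    linarith

variable {ι F E : Type*} [Fintype ι] [NormedAddCommGroup F] [NormedSpace ℝ F]
  [FiniteDimensional ℝ F] [NormedAddCommGroup E] [NormedSpace ℝ E]

/-- With `A` injective on the support there is at most one candidate solution, and the inverse is
Lipschitz. The additive error becomes a relative one because the positive entries of the solution
are bounded below by some `m`. If there is no solution, closedness of the image cone makes the claim
vacuous for small `δ`. -/
theorem exists_nonneg_solution_near_of_injOn (A : F × (ι → ℝ) →ₗ[ℝ] E) (c : E) (S : Finset ι)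
    (hinj : ∀ κ : F × (ι → ℝ), (∀ i ∉ S, κ.2 i = 0) → A κ = 0 → κ = 0) :
    ∃ C : ℝ, 0 ≤ C ∧ ∃ δ : ℝ, 0 < δ ∧ ∀ lam : F × (ι → ℝ), (∀ i ∉ S, lam.2 i = 0) →
      (∀ i, 0 ≤ lam.2 i) → ‖A lam - c‖ ≤ δ → ∃ lam' : F × (ι → ℝ), A lam' = c ∧
        (∀ i, 0 ≤ lam'.2 i) ∧ (∀ i, lam'.2 i ≤ (1 + C * ‖A lam - c‖) * lam.2 i) ∧
        ‖lam' - lam‖ ≤ C * ‖A lam - c‖ := by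
  let W : Submodule ℝ (F × (ι → ℝ)) :=
    { carrier := {κ | ∀ i ∉ S, κ.2 i = 0}
      add_mem' := fun {x y} hx hy i hi => by simp [hx i hi, hy i hi]
      zero_mem' := fun i _ => rfl
      smul_mem' := fun r x hx i hi => by simp [hx i hi] }
  have hker : LinearMap.ker (A.domRestrict W) = ⊥ := by
    rw [LinearMap.ker_eq_bot']
    intro w hw
    exact Subtype.ext (hinj w w.2 hw)
  obtain ⟨K, -, hK⟩ := (A.domRestrict W).exists_antilipschitzWith hker
  have hclosed : IsClosed (A.domRestrict W '' {w | ∀ i, 0 ≤ (w : F × (ι → ℝ)).2 i}) := by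
    apply (LinearMap.isClosedEmbedding_of_injective hker).isClosedMap
    simp only [Set.ofPred_forall]
    refine isClosed_iInter fun i => isClosed_le continuous_const ?_
    fun_prop
  by_cases hc : c ∈ A.domRestrict W '' {w | ∀ i, 0 ≤ (w : F × (ι → ℝ)).2 i}
  · obtain ⟨w, hw, hwc⟩ := hc
    obtain ⟨m, hm0, hm⟩ := exists_pos_forall_le (u := (w : F × (ι → ℝ)).2)
    have hK0 : (0 : ℝ) ≤ K := K.2
    refine ⟨K + 2 * K / m, by positivity, m / (2 * (K + 1)), by positivity,
      fun lam hS h0 hδ => ⟨w, hwc, hw, fun i => ?_, ?_⟩⟩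
    · have hdist : ‖(w : F × (ι → ℝ)) - lam‖ ≤ K * ‖A lam - c‖ := by
        have := hK.le_mul_dist ⟨lam, hS⟩ w
        rw [hwc, Subtype.dist_eq, dist_eq_norm, dist_eq_norm, norm_sub_rev] at this
        exact this
      have hi : (w : F × (ι → ℝ)).2 i - lam.2 i ≤ K * ‖A lam - c‖ :=
        (le_abs_self _).trans (((norm_le_pi_norm ((w : F × (ι → ℝ)) - lam).2 i).trans
          (norm_snd_le _)).trans hdist)
      have hp := norm_nonneg (A lam - c)
      rcases (hw i).eq_or_lt with h | h
      · rw [← h]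
        have := h0 i
        positivity
      · have h1 := hm i h
        rw [le_div_iff₀ (by positivity)] at hδ
        have h2 : m / 2 ≤ lam.2 i := by nlinarith
        have h3 : K * ‖A lam - c‖ ≤ (2 * K / m * ‖A lam - c‖) * lam.2 i := by
          calc K * ‖A lam - c‖ = (2 * K / m * ‖A lam - c‖) * (m / 2) := by field_simp
            _ ≤ _ := mul_le_mul_of_nonneg_left h2 (by positivity)
        have h4 : 0 ≤ K * ‖A lam - c‖ * lam.2 i := by have := h0 i; positivity
        linarith
    · have := hK.le_mul_dist ⟨lam, hS⟩ w
      rw [hwc, Subtype.dist_eq, dist_eq_norm, dist_eq_norm, norm_sub_rev] at this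
      refine this.trans (mul_le_mul_of_nonneg_right ?_ (norm_nonneg _))
      have : 0 ≤ 2 * K / m := by positivity
      linarith
  · by_cases hne : (A.domRestrict W '' {w | ∀ i, 0 ≤ (w : F × (ι → ℝ)).2 i}).Nonempty
    · have hpos := (hclosed.notMem_iff_infDist_pos hne).1 hc
      refine ⟨0, le_rfl, _, half_pos hpos, fun lam hS h0 hδ => ?_⟩
      have := Metric.infDist_le_dist_of_mem (x := c)
        (Set.mem_image_of_mem (A.domRestrict W) (show (⟨lam, hS⟩ : W) ∈
          {w : W | ∀ i, 0 ≤ (w : F × (ι → ℝ)).2 i} from h0))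
      rw [dist_comm, dist_eq_norm] at this
      have h2 : ‖A.domRestrict W ⟨lam, hS⟩ - c‖ = ‖A lam - c‖ := rfl
      linarith
    · exact absurd ⟨_, Set.mem_image_of_mem _ (show (0 : W) ∈
        {w : W | ∀ i, 0 ≤ (w : F × (ι → ℝ)).2 i} from fun i => le_rfl)⟩ hne

/-- A multiplicative error bound for nonnegative solutions of a linear system. -/
theorem exists_nonneg_solution_near (A : F × (ι → ℝ) →ₗ[ℝ] E) (c : E) (S : Finset ι)
    (hpos : ∀ κ : F × (ι → ℝ), (∀ i ∉ S, κ.2 i = 0) → (∀ i, 0 ≤ κ.2 i) → A κ = 0 → κ = 0) :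
    ∃ C : ℝ, 0 ≤ C ∧ ∃ δ : ℝ, 0 < δ ∧ ∀ lam : F × (ι → ℝ), (∀ i ∉ S, lam.2 i = 0) →
      (∀ i, 0 ≤ lam.2 i) → ‖A lam - c‖ ≤ δ → ∃ lam' : F × (ι → ℝ), A lam' = c ∧
        (∀ i, 0 ≤ lam'.2 i) ∧ (∀ i, lam'.2 i ≤ (1 + C * ‖A lam - c‖) * lam.2 i) ∧
        ‖lam' - lam‖ ≤ C * ‖A lam - c‖ := by
  classical
  induction S using Finset.strongInduction with
  | H S ih =>
  by_cases hinj : ∀ κ : F × (ι → ℝ), (∀ i ∉ S, κ.2 i = 0) → A κ = 0 → κ = 0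
  · exact exists_nonneg_solution_near_of_injOn A c S hinj
  -- By `hpos` the kernel vector `κ` has entries of both signs. So `lam` lies on a segment in
  -- direction `κ` whose ends are nonnegative, have smaller support and the same image under `A`;
  -- induction applies to both ends.
  push Not at hinj
  obtain ⟨κ, hκS, hAκ, hκ0⟩ := hinj
  have hneg1 : ∃ i, κ.2 i < 0 := by
    by_contra! h
    exact hκ0 (hpos κ hκS h hAκ)
  have hneg2 : ∃ i, (-κ).2 i < 0 := by
    by_contra! h
    exact hκ0 (neg_eq_zero.1 (hpos (-κ) (fun i hi => by simp [hκS i hi]) h (by simp [hAκ])))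
  have hsub : ∀ i, ∃ C : ℝ, 0 ≤ C ∧ ∃ δ : ℝ, 0 < δ ∧ (i ∈ S → ∀ lam : F × (ι → ℝ),
      (∀ j ∉ S.erase i, lam.2 j = 0) →
      (∀ i, 0 ≤ lam.2 i) → ‖A lam - c‖ ≤ δ → ∃ lam' : F × (ι → ℝ), A lam' = c ∧
        (∀ i, 0 ≤ lam'.2 i) ∧ (∀ i, lam'.2 i ≤ (1 + C * ‖A lam - c‖) * lam.2 i) ∧
        ‖lam' - lam‖ ≤ C * ‖A lam - c‖) := by
    intro i
    by_cases hi : i ∈ S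
    · obtain ⟨C, hC, δ, hδ, h⟩ := ih (S.erase i) (Finset.erase_ssubset hi) fun κ hκ =>
        hpos κ fun j hj => hκ j fun h => hj (Finset.mem_of_mem_erase h)
      exact ⟨C, hC, δ, hδ, fun _ => h⟩
    · exact ⟨0, le_rfl, 1, one_pos, fun h => absurd h hi⟩
  choose C hC δ hδ hsol using hsub
  obtain ⟨m, hm0, hm⟩ := exists_pos_forall_le (u := δ)
  have hCle : ∀ i, C i ≤ ∑ j, C j := fun i =>
    Finset.single_le_sum (fun j _ => hC j) (Finset.mem_univ i)
  have hsol' : ∀ i ∈ S, ∀ lam : F × (ι → ℝ), (∀ j ∉ S, lam.2 j = 0) → lam.2 i = 0 →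
      (∀ i, 0 ≤ lam.2 i) → ‖A lam - c‖ ≤ m → ∃ lam' : F × (ι → ℝ), A lam' = c ∧
        (∀ i, 0 ≤ lam'.2 i) ∧ (∀ i, lam'.2 i ≤ (1 + (∑ j, C j) * ‖A lam - c‖) * lam.2 i) ∧
        ‖lam' - lam‖ ≤ (∑ j, C j) * ‖A lam - c‖ := by
    intro i hi lam hS hlami h0 hle
    obtain ⟨lam', h1, h2, h3, h4⟩ := hsol i hi lam (fun j hj => by
      by_cases hji : j = i
      · rw [hji, hlami]
      · exact hS j fun h => hj (Finset.mem_erase.2 ⟨hji, h⟩)) h0 (hle.trans (hm i (hδ i)))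
    have hmul := mul_le_mul_of_nonneg_right (hCle i) (norm_nonneg (A lam - c))
    refine ⟨lam', h1, h2, fun j => (h3 j).trans ?_, h4.trans hmul⟩
    exact mul_le_mul_of_nonneg_right (by linarith) (h0 j)
  refine ⟨∑ j, C j, Finset.sum_nonneg fun j _ => hC j, m, hm0, fun lam hS h0 hle => ?_⟩
  obtain ⟨t, ht0, ht, i, hi, hti⟩ := exists_add_smul_nonneg_eq_zero h0 hκS hneg1
  obtain ⟨s, hs0, hs, j, hj, hsj⟩ := exists_add_smul_nonneg_eq_zero h0
    (d := (-κ).2) (fun i hi => by simp [hκS i hi]) hneg2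
  rcases ht0.eq_or_lt with h | htpos
  · exact hsol' i hi lam hS (by simpa [← h] using hti) h0 hle
  have hA1 : A (lam + t • κ) = A lam := by simp [hAκ]
  have hA2 : A (lam + s • (-κ)) = A lam := by simp [hAκ]
  obtain ⟨l1, a1, b1, c1, d1⟩ := hsol' i hi (lam + t • κ)
    (fun k hk => by simp [hS k hk, hκS k hk]) (by simpa using hti) (by simpa using ht)
    (by rwa [hA1])
  obtain ⟨l2, a2, b2, c2, d2⟩ := hsol' j hj (lam + s • (-κ))
    (fun k hk => by simp [hS k hk, hκS k hk]) (by simpa using hsj) (by simpa using hs)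
    (by rwa [hA2])
  rw [hA1] at c1 d1
  rw [hA2] at c2 d2
  have hts : 0 < t + s := by linarith
  -- Weights that recombine the two ends into `lam`; the relative bound is linear in the multiplier
  -- and so survives.
  obtain ⟨p, q, hp, hq, hpq, hpt⟩ : ∃ p q : ℝ, 0 ≤ p ∧ 0 ≤ q ∧ p + q = 1 ∧ p * t = q * s :=
    ⟨s / (t + s), t / (t + s), by positivity, by positivity, by field_simp; ring, by ring⟩
  refine ⟨p • l1 + q • l2, ?_, fun k => ?_, fun k => ?_, ?_⟩
  · rw [map_add, map_smul, map_smul, a1, a2, ← add_smul, hpq, one_smul]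
  · have h1 := mul_nonneg hp (b1 k)
    have h2 := mul_nonneg hq (b2 k)
    simpa using add_nonneg h1 h2
  · have h1 := mul_le_mul_of_nonneg_left (c1 k) hp
    have h2 := mul_le_mul_of_nonneg_left (c2 k) hq
    simp only [Prod.snd_add, Prod.smul_snd, Pi.add_apply, Pi.smul_apply, smul_eq_mul,
      Prod.snd_neg, Pi.neg_apply] at h1 h2 ⊢
    set X := 1 + (∑ j, C j) * ‖A lam - c‖
    calc p * l1.2 k + q * l2.2 k ≤ _ := add_le_add h1 h2
      _ = (p + q) * X * lam.2 k + X * κ.2 k * (p * t - q * s) := by ring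
      _ = X * lam.2 k := by rw [hpq, hpt]; ring
  · have heq : p • l1 + q • l2 - lam = p • (l1 - (lam + t • κ)) + q • (l2 - (lam + s • (-κ))) := by
      have h1 : lam = p • lam + q • lam := by rw [← add_smul, hpq, one_smul]
      have h2 : p • t • κ = q • s • κ := by rw [smul_smul, smul_smul, hpt]
      nth_rewrite 1 [h1]
      simp only [smul_sub, smul_add, smul_neg, h2]
      abel
    rw [heq]
    refine (norm_add_le _ _).trans ?_
    rw [norm_smul, norm_smul, Real.norm_of_nonneg hp, Real.norm_of_nonneg hq]
    have h1 := mul_le_mul_of_nonneg_left d1 hp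
    have h2 := mul_le_mul_of_nonneg_left d2 hq
    calc _ ≤ _ := add_le_add h1 h2
      _ = (p + q) * ((∑ j, C j) * ‖A lam - c‖) := by ring
      _ = _ := by rw [hpq, one_mul]

end Polyhedral

/-! ### Perturbed geometric recursions. -/

section Sequences

theorem exists_le_mul_pow_of_succ_le {U ε : ℕ → ℝ} {β : ℝ} (hβ : 0 < β) (hU : ∀ k, 0 ≤ U k)
    (hε : ∀ k, 0 ≤ ε k) (hsum : Summable ε) (h : ∀ k, U (k + 1) ≤ β * (1 + ε k) * U k) :
    ∃ C : ℝ, ∀ k, U k ≤ C * β ^ k := by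
  refine ⟨U 0 * Real.exp (∑' j, ε j), fun k => ?_⟩
  have key : ∀ k, U k ≤ U 0 * Real.exp (∑ j ∈ Finset.range k, ε j) * β ^ k := by
    intro k
    induction k with
    | zero => simp
    | succ k ih =>
      rw [Finset.sum_range_succ, Real.exp_add, pow_succ]
      have h1 : 1 + ε k ≤ Real.exp (ε k) := by linarith [Real.add_one_le_exp (ε k)]
      calc U (k + 1) ≤ β * (1 + ε k) * U k := h k
        _ ≤ β * Real.exp (ε k) * (U 0 * Real.exp (∑ j ∈ Finset.range k, ε j) * β ^ k) := by
          have := hU k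
          gcongr
        _ = _ := by ring
  refine (key k).trans ?_
  have := hU 0
  gcongr
  exact hsum.sum_le_tsum _ fun j _ => hε j

theorem exists_le_mul_pow_of_eventually {U : ℕ → ℝ} {β : ℝ} (hβ : 0 < β)
    (h : ∃ C : ℝ, ∀ᶠ k in atTop, U k ≤ C * β ^ k) : ∃ C : ℝ, 0 < C ∧ ∀ k, U k ≤ C * β ^ k := by
  obtain ⟨C, h⟩ := h
  obtain ⟨N, hN⟩ := eventually_atTop.1 h
  refine ⟨|C| + 1 + ∑ j ∈ Finset.range N, |U j| / β ^ j, ?_, fun k => ?_⟩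
  · have : 0 ≤ ∑ j ∈ Finset.range N, |U j| / β ^ j := Finset.sum_nonneg fun j _ => by positivity
    positivity
  · have hs : 0 ≤ ∑ j ∈ Finset.range N, |U j| / β ^ j := Finset.sum_nonneg fun j _ => by positivity
    by_cases hk : N ≤ k
    · refine (hN k hk).trans ?_
      gcongr
      linarith [le_abs_self C]
    · have h1 : |U k| / β ^ k ≤ ∑ j ∈ Finset.range N, |U j| / β ^ j :=
        Finset.single_le_sum (f := fun j => |U j| / β ^ j) (fun j _ => by positivity)
          (Finset.mem_range.2 (not_le.1 hk))
      rw [div_le_iff₀ (by positivity)] at h1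
      refine (le_abs_self _).trans (h1.trans ?_)
      gcongr
      linarith [abs_nonneg C]

/-- A perturbed linear recursion whose perturbation is of the order of the square root of the
sequence still decays at the unperturbed rate. -/
theorem exists_le_mul_pow_of_sqrt_perturbation {U η : ℕ → ℝ} {β D : ℝ} (hβ : 0 < β) (hβ1 : β < 1)
    (hU : ∀ k, 0 ≤ U k) (hη0 : ∀ k, 0 ≤ η k) (hη : Tendsto η atTop (𝓝 0)) (hD : 0 ≤ D)
    (hηU : ∀ᶠ k in atTop, η k ≤ D * (√(U k) + √(U (k + 1))))
    (h : ∀ᶠ k in atTop, U (k + 1) ≤ β * U k + η k * U (k + 1)) :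
    ∃ C : ℝ, ∀ᶠ k in atTop, U k ≤ C * β ^ k := by
  obtain ⟨N, hN⟩ : ∃ N, ∀ k ≥ N, η k ≤ 1 / 2 ∧ β * (1 + 2 * η k) ≤ (1 + β) / 2 ∧
      η k ≤ D * (√(U k) + √(U (k + 1))) ∧ U (k + 1) ≤ β * U k + η k * U (k + 1) := by
    rw [← eventually_atTop]
    have h1 : ∀ᶠ k in atTop, η k ≤ 1 / 2 := hη.eventually_le_const (by norm_num)
    have h2 : ∀ᶠ k in atTop, η k ≤ (1 - β) / 4 := hη.eventually_le_const (by linarith)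
    filter_upwards [h1, h2, hηU, h] with k a1 a2 a3 a4
    refine ⟨a1, ?_, a3, a4⟩
    nlinarith [hη0 k]
  -- The implicit recursion is solved with `1 / (1 - η) ≤ 1 + 2η`, valid for `η ≤ 1 / 2`.
  have hstep : ∀ k ≥ N, U (k + 1) ≤ β * (1 + 2 * η k) * U k := by
    intro k hk
    obtain ⟨a1, -, -, a4⟩ := hN k hk
    have h0 := hη0 k
    have h1 : (1 - η k) * U (k + 1) ≤ (1 - η k) * (β * (1 + 2 * η k) * U k) := by
      have : 0 ≤ β * U k * (η k * (1 - 2 * η k)) :=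
        mul_nonneg (mul_nonneg hβ.le (hU k)) (mul_nonneg h0 (by linarith))
      nlinarith
    exact le_of_mul_le_mul_left h1 (by linarith)
  -- The cruder rate `γ < 1` already makes `√U`, hence `η`, summable; the product of the factors `1
  -- + 2η` is then bounded and rate `β` follows.
  set γ := (1 + β) / 2 with hγ
  have hγ0 : 0 < γ := by linarith
  have hγ1 : γ < 1 := by linarith
  have hgeo : ∀ k, U (N + k) ≤ U N * γ ^ k := by
    intro k
    induction k with
    | zero => simp
    | succ k ih =>
      have h1 := hstep (N + k) (by omega)
      have h2 := (hN (N + k) (by omega)).2.1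
      calc U (N + (k + 1)) ≤ _ := h1
        _ ≤ γ * (U N * γ ^ k) := mul_le_mul h2 ih (hU _) hγ0.le
        _ = _ := by ring
  have hsq : ∀ k, √(U (N + k)) ≤ √(U N) * √γ ^ k := by
    intro k
    rw [Real.sqrt_le_left (by positivity), mul_pow, Real.sq_sqrt (hU N), ← pow_mul, mul_comm k 2,
      pow_mul, Real.sq_sqrt hγ0.le]
    exact hgeo k
  have hγs : √γ < 1 := by rw [Real.sqrt_lt' one_pos]; simpa using hγ1
  have hsummable : Summable fun k => 2 * η (N + k) := by
    apply Summable.mul_left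
    refine Summable.of_nonneg_of_le (fun k => hη0 _) (fun k => ?_)
      ((summable_geometric_of_lt_one (Real.sqrt_nonneg γ) hγs).mul_left (D * (2 * √(U N))))
    have h1 := (hN (N + k) (by omega)).2.2.1
    have h2 := hsq k
    have h3 := hsq (k + 1)
    have h4 : √(U N) * √γ ^ (k + 1) ≤ √(U N) * √γ ^ k := by
      have := pow_le_pow_of_le_one (Real.sqrt_nonneg γ) hγs.le (Nat.le_succ k)
      gcongr
    calc η (N + k) ≤ D * (√(U (N + k)) + √(U (N + (k + 1)))) := h1
      _ ≤ D * (√(U N) * √γ ^ k + √(U N) * √γ ^ k) := by gcongr; exact h3.trans h4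
      _ = _ := by ring
  obtain ⟨C, hC⟩ := exists_le_mul_pow_of_succ_le hβ (fun k => hU (N + k))
    (fun k => mul_nonneg zero_le_two (hη0 (N + k))) hsummable (fun k => hstep (N + k) (by omega))
  refine ⟨C / β ^ N, eventually_atTop.2 ⟨N, fun k hk => ?_⟩⟩
  obtain ⟨j, rfl⟩ := Nat.exists_eq_add_of_le hk
  refine (hC j).trans_eq ?_
  rw [pow_add]
  field_simp

/-- A two-dimensional version: a fast quantity `r`, driven with small gain by a slow quantity `φ`,
which in turn is driven by `r`. -/
theorem exists_le_mul_pow_of_coupled {r φ η : ℕ → ℝ} {β ρ D : ℝ} (hβ1 : β < 1)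
    (hρ : 0 ≤ ρ) (hρβ : ρ < β) (hD : 0 ≤ D) (hr : ∀ k, 0 ≤ r k) (hη0 : ∀ k, 0 ≤ η k)
    (hr0 : Tendsto r atTop (𝓝 0))
    (hη : ∀ᶠ k in atTop, η k ≤ D * (√(r k) + √(r (k + 1))))
    (h1 : ∀ᶠ k in atTop, r (k + 1) ≤ ρ * r k +
      η k * (φ (k + 1) + D * β ^ (k + 1) + D * r (k + 1)))
    (h2 : ∀ᶠ k in atTop, φ (k + 1) ≤ β * φ k + D * (r k + r (k + 1)))
    (h3 : ∀ᶠ k in atTop, 0 ≤ φ k + D * β ^ k + D * r k) :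
    ∃ C : ℝ, ∀ᶠ k in atTop, r k ≤ C * β ^ k := by
  have hβ : 0 < β := by linarith
  -- The weight of `r` in `U`: large enough to absorb the forcing of `φ` by `r`, possible because `ρ
  -- < β`.
  obtain ⟨M, hM1, hM⟩ : ∃ M : ℝ, 1 ≤ M ∧ 2 * D + (M + 2 * D) * ρ ≤ M * β := by
    refine ⟨max 1 (2 * D * (1 + ρ) / (β - ρ)), le_max_left _ _, ?_⟩
    have := le_max_right 1 (2 * D * (1 + ρ) / (β - ρ))
    rw [div_le_iff₀ (by linarith)] at this
    linarith
  set P : ℕ → ℝ := fun k => max 0 (φ k + D * β ^ k + D * r k) with hP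
  set U : ℕ → ℝ := fun k => P k + M * r k with hUd
  have hP0 : ∀ k, 0 ≤ P k := fun k => le_max_left _ _
  have hrU : ∀ k, r k ≤ U k := fun k => by
    have := hP0 k
    have := hr k
    simp only [hUd]
    nlinarith
  have hU0 : ∀ k, 0 ≤ U k := fun k => (hr k).trans (hrU k)
  have hsr : Tendsto (fun k => √(r k)) atTop (𝓝 0) := by
    have := (Real.continuous_sqrt.tendsto 0).comp hr0
    rwa [Real.sqrt_zero] at this
  have hη' : Tendsto η atTop (𝓝 0) := by
    refine squeeze_zero' (Eventually.of_forall hη0) hη ?_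
    simpa using (hsr.add (hsr.comp (tendsto_add_atTop_nat 1))).const_mul D
  obtain ⟨C, hC⟩ := exists_le_mul_pow_of_sqrt_perturbation (U := U)
    (η := fun k => (M + 2 * D) * η k) (D := (M + 2 * D) * D) hβ hβ1 hU0
    (fun k => mul_nonneg (by positivity) (hη0 k))
    (by simpa using hη'.const_mul (M + 2 * D)) (by positivity) (by
      filter_upwards [hη] with k hk
      calc (M + 2 * D) * η k ≤ (M + 2 * D) * (D * (√(r k) + √(r (k + 1)))) := by gcongr
        _ ≤ (M + 2 * D) * (D * (√(U k) + √(U (k + 1)))) := by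
          gcongr
          · exact hrU k
          · exact hrU (k + 1)
        _ = _ := by ring) (by
      filter_upwards [h1, h2, h3, (tendsto_add_atTop_nat 1).eventually h3] with k a1 a2 a3 a4
      have e1 : P k = φ k + D * β ^ k + D * r k := max_eq_right a3
      have e2 : P (k + 1) = φ (k + 1) + D * β ^ (k + 1) + D * r (k + 1) := max_eq_right a4
      rw [← e2] at a1
      have hrk := hr k
      have hPU : P (k + 1) ≤ U (k + 1) := by
        have := hr (k + 1)
        simp only [hUd]
        nlinarith
      have b1 : r (k + 1) ≤ ρ * r k + η k * U (k + 1) :=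
        a1.trans (by have := hη0 k; gcongr)
      have b2 : P (k + 1) ≤ β * P k + 2 * D * (r k + r (k + 1)) := by
        rw [e1, e2, pow_succ]
        nlinarith [mul_nonneg hD hrk, mul_nonneg hβ.le (mul_nonneg hD hrk)]
      have b3 := mul_le_mul_of_nonneg_left b1 (by positivity : 0 ≤ M + 2 * D)
      have b4 := mul_le_mul_of_nonneg_right hM hrk
      simp only [hUd] at b3 ⊢
      nlinarith)
  exact ⟨C, hC.mono fun k hk => (hrU k).trans hk⟩

end Sequences

/-! ### Lagrangian, optimality conditions for the velocity, and well-posedness of the iteration. -/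

namespace ConstrainedProblem

variable {n ng nh : ℕ} {P : ConstrainedProblem n ng nh}

/-- The linear map `lam ↦ ∑ lam_j ∇h_j(x) + ∑ lam_i ∇g_i(x)`. -/
noncomputable def constraintGradient (P : ConstrainedProblem n ng nh)
    (x : EuclideanSpace ℝ (Fin n)) :
    (Fin nh → ℝ) × (Fin ng → ℝ) →ₗ[ℝ] EuclideanSpace ℝ (Fin n) :=
  (Fintype.linearCombination ℝ fun j => gradient (P.h j) x).coprod
    (Fintype.linearCombination ℝ fun i => gradient (P.g i) x)

theorem constraintGradient_apply (x : EuclideanSpace ℝ (Fin n))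
    (κ : (Fin nh → ℝ) × (Fin ng → ℝ)) :
    P.constraintGradient x κ =
      ∑ j, κ.1 j • gradient (P.h j) x + ∑ i, κ.2 i • gradient (P.g i) x := by
  simp [constraintGradient, Fintype.linearCombination_apply]

theorem inner_constraintGradient (x u : EuclideanSpace ℝ (Fin n))
    (κ : (Fin nh → ℝ) × (Fin ng → ℝ)) :
    inner ℝ (P.constraintGradient x κ) u =
      ∑ j, κ.1 j * inner ℝ (gradient (P.h j) x) u +
        ∑ i, κ.2 i * inner ℝ (gradient (P.g i) x) u := by
  rw [constraintGradient_apply, inner_add_left, sum_inner, sum_inner]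
  simp only [real_inner_smul_left]

theorem _root_.IsC1LipschitzGradient.differentiable {φ : EuclideanSpace ℝ (Fin n) → ℝ}
    (h : IsC1LipschitzGradient φ) : Differentiable ℝ φ :=
  h.1.differentiable (by norm_num)

theorem _root_.IsC1LipschitzGradient.exists_norm_sub_le {φ : EuclideanSpace ℝ (Fin n) → ℝ}
    (h : IsC1LipschitzGradient φ) :
    ∃ K : ℝ, 0 ≤ K ∧ ∀ y z, ‖gradient φ y - gradient φ z‖ ≤ K * ‖y - z‖ := by
  obtain ⟨K, hK⟩ := h.2
  exact ⟨K, K.2, fun y z => by simpa [dist_eq_norm] using hK.dist_le_mul y z⟩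

theorem _root_.IsC1LipschitzGradient.continuous_gradient {φ : EuclideanSpace ℝ (Fin n) → ℝ}
    (h : IsC1LipschitzGradient φ) : Continuous (gradient φ) := by
  obtain ⟨K, hK⟩ := h.2
  exact hK.continuous

namespace Standing

variable (hP : P.Standing)
include hP

theorem hasGradientAt_lagrangian (lam : (Fin nh → ℝ) × (Fin ng → ℝ))
    (x : EuclideanSpace ℝ (Fin n)) :
    HasGradientAt (P.lagrangian lam) (gradient P.f x - P.constraintGradient x lam) x := by
  apply (hP.smooth_f.differentiable x).hasGradientAt.sub'
  rw [hasGradientAt_iff_hasFDerivAt, constraintGradient_apply, map_add, map_sum, map_sum]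
  simp only [map_smul]
  refine HasFDerivAt.add (HasFDerivAt.fun_sum fun j _ => ?_) (HasFDerivAt.fun_sum fun i _ => ?_)
  · exact ((hP.smooth_h j).differentiable x).hasGradientAt.hasFDerivAt.const_mul (lam.1 j)
  · exact ((hP.smooth_g i).differentiable x).hasGradientAt.hasFDerivAt.const_mul (lam.2 i)

theorem gradient_lagrangian (lam : (Fin nh → ℝ) × (Fin ng → ℝ))
    (x : EuclideanSpace ℝ (Fin n)) :
    gradient (P.lagrangian lam) x = gradient P.f x - P.constraintGradient x lam :=
  (hP.hasGradientAt_lagrangian lam x).gradient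

theorem differentiable_lagrangian (lam : (Fin nh → ℝ) × (Fin ng → ℝ)) :
    Differentiable ℝ (P.lagrangian lam) := fun x =>
  (hP.hasGradientAt_lagrangian lam x).differentiableAt

theorem exists_norm_constraintGradient_sub_le :
    ∃ K : ℝ, 0 ≤ K ∧ ∀ y z κ, ‖P.constraintGradient y κ - P.constraintGradient z κ‖ ≤
      K * ‖y - z‖ * ‖κ‖ := by
  choose Kh hKh0 hKh using fun j => (hP.smooth_h j).exists_norm_sub_le
  choose Kg hKg0 hKg using fun i => (hP.smooth_g i).exists_norm_sub_le
  refine ⟨∑ j, Kh j + ∑ i, Kg i, add_nonneg (Finset.sum_nonneg fun j _ => hKh0 j)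
    (Finset.sum_nonneg fun i _ => hKg0 i), fun y z κ => ?_⟩
  rw [constraintGradient_apply, constraintGradient_apply, add_sub_add_comm,
    ← Finset.sum_sub_distrib, ← Finset.sum_sub_distrib, add_mul, add_mul, Finset.sum_mul,
    Finset.sum_mul, Finset.sum_mul, Finset.sum_mul]
  refine (norm_add_le _ _).trans (add_le_add ?_ ?_)
  · refine norm_sum_le_of_le _ fun j _ => ?_
    rw [← smul_sub, norm_smul, mul_comm]
    exact mul_le_mul (hKh j y z) ((norm_le_pi_norm κ.1 j).trans (norm_fst_le κ)) (norm_nonneg _)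
      (mul_nonneg (hKh0 j) (norm_nonneg _))
  · refine norm_sum_le_of_le _ fun i _ => ?_
    rw [← smul_sub, norm_smul, mul_comm]
    exact mul_le_mul (hKg i y z) ((norm_le_pi_norm κ.2 i).trans (norm_snd_le κ)) (norm_nonneg _)
      (mul_nonneg (hKg0 i) (norm_nonneg _))

/-- The infimum in `smoothnessConstant` is itself a Lipschitz constant. Some Lipschitz constant has
to be exhibited, since `sInf ∅ = 0` would carry no information. -/
theorem norm_gradient_lagrangian_sub_le {lam : (Fin nh → ℝ) × (Fin ng → ℝ)} {L : ℝ}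
    (hL : smoothnessConstant (P.lagrangian lam) ≤ L) (y z : EuclideanSpace ℝ (Fin n)) :
    ‖gradient (P.lagrangian lam) y - gradient (P.lagrangian lam) z‖ ≤ L * ‖y - z‖ := by
  refine le_trans ?_ (mul_le_mul_of_nonneg_right hL (norm_nonneg _))
  rcases eq_or_ne y z with rfl | hne
  · simp
  have hpos : 0 < ‖y - z‖ := norm_sub_pos_iff.2 hne
  rw [← div_le_iff₀ hpos]
  apply le_csInf
  · obtain ⟨K, hK0, hK⟩ := hP.exists_norm_constraintGradient_sub_le
    obtain ⟨Kf, hKf0, hKf⟩ := hP.smooth_f.exists_norm_sub_le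
    refine ⟨Kf + K * ‖lam‖, by positivity, fun y z => ?_⟩
    rw [hP.gradient_lagrangian, hP.gradient_lagrangian, sub_sub_sub_comm]
    refine (norm_sub_le _ _).trans ((add_le_add (hKf y z) (hK y z lam)).trans_eq ?_)
    ring
  · rintro K ⟨-, hK⟩
    rw [div_le_iff₀ hpos]
    exact hK y z

end Standing

theorem Convexity.h_combo {μ : ℝ} (hc : P.Convexity μ) (j : Fin nh)
    (x y : EuclideanSpace ℝ (Fin n)) {a b : ℝ} (hab : a + b = 1) :
    P.h j (a • x + b • y) = a * P.h j x + b * P.h j y := by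
  obtain ⟨A, hA⟩ := hc.affine_h j
  rw [hA, hA, hA, Convex.combo_affine_apply hab]
  rfl

theorem Convexity.h_eq {μ : ℝ} (hc : P.Convexity μ) (hP : P.Standing) (j : Fin nh)
    (x y : EuclideanSpace ℝ (Fin n)) :
    P.h j y = P.h j x + inner ℝ (gradient (P.h j) x) (y - x) := by
  have hcv : ConvexOn ℝ Set.univ (P.h j) := ⟨convex_univ, fun x _ y _ a b _ _ hab => by
    rw [hc.h_combo j x y hab]; rfl⟩
  have hcc : ConcaveOn ℝ Set.univ (P.h j) := ⟨convex_univ, fun x _ y _ a b _ _ hab => by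
    rw [hc.h_combo j x y hab]; rfl⟩
  have hd := (hP.smooth_h j).differentiable
  exact le_antisymm (hcc.le_add_inner_gradient hd x y) (hcv.add_inner_gradient_le hd x y)

theorem Convexity.strongConvexOn_lagrangian {μ : ℝ} (hc : P.Convexity μ)
    {lam : (Fin nh → ℝ) × (Fin ng → ℝ)} (h0 : ∀ i, 0 ≤ lam.2 i) :
    StrongConvexOn Set.univ μ (P.lagrangian lam) := by
  have hf := hc.strongConvex_f
  refine ⟨convex_univ, fun x hx y hy a b ha hb hab => ?_⟩
  have h1 := hf.2 hx hy ha hb hab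
  have h2 : a * (∑ j, lam.1 j * P.h j x) + b * ∑ j, lam.1 j * P.h j y =
      ∑ j, lam.1 j * P.h j (a • x + b • y) := by
    rw [Finset.mul_sum, Finset.mul_sum, ← Finset.sum_add_distrib]
    refine Finset.sum_congr rfl fun j _ => ?_
    rw [hc.h_combo j x y hab]
    ring
  have h3 : a * (∑ i, lam.2 i * P.g i x) + b * ∑ i, lam.2 i * P.g i y ≤
      ∑ i, lam.2 i * P.g i (a • x + b • y) := by
    rw [Finset.mul_sum, Finset.mul_sum, ← Finset.sum_add_distrib]
    refine Finset.sum_le_sum fun i _ => ?_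
    have := mul_le_mul_of_nonneg_left ((hc.concave_g i).2 hx hy ha hb hab) (h0 i)
    simp only [smul_eq_mul] at this
    linarith
  simp only [lagrangian, smul_eq_mul] at h1 ⊢
  linarith

/-- The optimality conditions for `-∇ₓ l(x, lam)` to be the velocity at `x`. -/
structure IsKKT (P : ConstrainedProblem n ng nh) (α : ℝ) (x : EuclideanSpace ℝ (Fin n))
    (lam : (Fin nh → ℝ) × (Fin ng → ℝ)) : Prop where
  mem_multipliers : lam ∈ P.multipliers x
  mem_admissible : P.constraintGradient x lam - gradient P.f x ∈ P.admissible α x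
  complementary : ∀ i, lam.2 i * (inner ℝ (gradient (P.g i) x)
    (P.constraintGradient x lam - gradient P.f x) + α * P.g i x) = 0

/-- First-order optimality of the dual problem in a feasible direction `κ`: the objective is
quadratic along it, so a wrong sign of the linear term is contradicted at small `t`. -/
theorem IsDualSolution.inner_add_nonneg (hP : P.Standing) {α : ℝ} (hα : 0 < α)
    {x : EuclideanSpace ℝ (Fin n)} {lam : (Fin nh → ℝ) × (Fin ng → ℝ)}
    (h : P.IsDualSolution α x lam) {κ : (Fin nh → ℝ) × (Fin ng → ℝ)} {t₀ : ℝ} (ht₀ : 0 < t₀)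
    (hκ : ∀ t, 0 ≤ t → t ≤ t₀ → lam + t • κ ∈ P.multipliers x) :
    0 ≤ inner ℝ (P.constraintGradient x κ) (P.constraintGradient x lam - gradient P.f x) +
      α * (∑ j, κ.1 j * P.h j x + ∑ i, κ.2 i * P.g i x) := by
  set G := P.constraintGradient x κ with hG
  set v := P.constraintGradient x lam - gradient P.f x with hv
  set s := ∑ j, κ.1 j * P.h j x + ∑ i, κ.2 i * P.g i x with hs
  by_contra! hneg
  set b := inner ℝ G v + α * s with hb
  have key : ∀ t, 0 ≤ t → t ≤ t₀ → -(2 * t * b) ≤ t ^ 2 * ‖G‖ ^ 2 := by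
    intro t h0 h1
    have hmax := h.2 (hκ t h0 h1)
    have hl : P.lagrangian (lam + t • κ) x = P.lagrangian lam x - t * s := by
      simp only [lagrangian, hs, Prod.fst_add, Prod.snd_add, Prod.smul_fst, Prod.smul_snd,
        Pi.add_apply, Pi.smul_apply, smul_eq_mul, add_mul, Finset.sum_add_distrib, mul_add,
        Finset.mul_sum, mul_assoc]
      ring
    simp only [Set.mem_ofPred_eq, dualObjective, hP.gradient_lagrangian, hl, map_add,
      map_smul, ← hG] at hmax
    have e1 : gradient P.f x - (P.constraintGradient x lam + t • G) = -(v + t • G) := by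
      rw [hv]; abel
    have e2 : gradient P.f x - P.constraintGradient x lam = -v := by rw [hv]; abel
    rw [e1, e2, norm_neg, norm_neg, norm_add_sq_real, real_inner_smul_right, norm_smul, mul_pow,
      Real.norm_eq_abs, sq_abs, real_inner_comm] at hmax
    have h2 := mul_le_mul_of_nonneg_left hmax (by positivity : 0 ≤ 2 * α)
    have h3 : 2 * α * (1 / (2 * α)) = 1 := by field_simp
    have h4 : 2 * α * (P.lagrangian lam x - t * s -
        1 / (2 * α) * (‖v‖ ^ 2 + 2 * (t * inner ℝ G v) + t ^ 2 * ‖G‖ ^ 2)) =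
        2 * α * P.lagrangian lam x - 2 * α * t * s - (2 * α * (1 / (2 * α))) *
          (‖v‖ ^ 2 + 2 * (t * inner ℝ G v) + t ^ 2 * ‖G‖ ^ 2) := by ring
    have h5 : 2 * α * (P.lagrangian lam x - 1 / (2 * α) * ‖v‖ ^ 2) =
        2 * α * P.lagrangian lam x - (2 * α * (1 / (2 * α))) * ‖v‖ ^ 2 := by ring
    rw [h4, h5, h3] at h2
    rw [hb]
    linarith
  set t := min t₀ (-b / (‖G‖ ^ 2 + 1)) with ht
  have hpos : 0 < ‖G‖ ^ 2 + 1 := by positivity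
  have htpos : 0 < t := lt_min ht₀ (div_pos (by linarith) hpos)
  have h1 := key t htpos.le (min_le_left _ _)
  have h2 : t * (‖G‖ ^ 2 + 1) ≤ -b := (le_div_iff₀ hpos).1 (min_le_right _ _)
  nlinarith

theorem IsDualSolution.isKKT (hP : P.Standing) {α : ℝ} (hα : 0 < α)
    {x : EuclideanSpace ℝ (Fin n)} {lam : (Fin nh → ℝ) × (Fin ng → ℝ)}
    (h : P.IsDualSolution α x lam) : P.IsKKT α x lam := by
  classical
  have hle := fun (κ : (Fin nh → ℝ) × (Fin ng → ℝ)) (t₀ : ℝ) (ht₀ : 0 < t₀) =>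
    h.inner_add_nonneg hP hα (κ := κ) ht₀
  have hh : ∀ (j : Fin nh) (c : ℝ), 0 ≤ c * (inner ℝ (gradient (P.h j) x)
      (P.constraintGradient x lam - gradient P.f x) + α * P.h j x) := by
    intro j c
    have := hle (Pi.single j c, 0) 1 one_pos fun t _ _ => by
      refine ⟨fun i => ?_, fun i hi => ?_⟩
      · simpa using h.1.1 i
      · simpa using h.1.2 i hi
    rw [inner_constraintGradient] at this
    simp [Pi.single_apply] at this
    simp
    linarith
  have hg : ∀ (i : Fin ng) (c t₀ : ℝ), 0 < t₀ → (i ∉ P.active x → c = 0) → 0 ≤ lam.2 i + t₀ * c →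
      0 ≤ c * (inner ℝ (gradient (P.g i) x)
      (P.constraintGradient x lam - gradient P.f x) + α * P.g i x) := by
    intro i c t₀ ht₀ hc hc'
    have := hle (0, Pi.single i c) t₀ ht₀ fun t h0 h1 => by
      refine ⟨fun k => ?_, fun k hk => ?_⟩
      · by_cases hki : k = i
        · subst hki
          have := h.1.1 k
          rcases le_total 0 c with hc0 | hc0
          · simpa using add_nonneg this (mul_nonneg h0 hc0)
          · have : t₀ * c ≤ t * c := mul_le_mul_of_nonpos_right h1 hc0
            simp
            linarith
        · simpa [hki] using h.1.1 k
      · by_cases hki : k = i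
        · subst hki
          simp [h.1.2 k hk, hc hk]
        · simpa [hki] using h.1.2 k hk
    rw [inner_constraintGradient] at this
    simp [Pi.single_apply] at this
    simp
    linarith
  have hadm : P.constraintGradient x lam - gradient P.f x ∈ P.admissible α x := by
    refine ⟨fun j => ?_, fun i hi => ?_⟩
    · have h1 := hh j 1
      have h2 := hh j (-1)
      linarith
    · have h1 := hg i 1 1 one_pos (fun h => absurd hi h) (by linarith [h.1.1 i])
      linarith
  refine ⟨h.1, hadm, fun i => ?_⟩
  by_cases hi : i ∈ P.active x
  · apply le_antisymm
    · have := hg i (-lam.2 i) 1 one_pos (fun h => absurd hi h) (by linarith)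
      linarith
    · exact mul_nonneg (h.1.1 i) (hadm.2 i hi)
  · rw [h.1.2 i hi, zero_mul]

namespace IsKKT

variable {α : ℝ} {x : EuclideanSpace ℝ (Fin n)} {lam : (Fin nh → ℝ) × (Fin ng → ℝ)}

theorem inner_nonneg (h : P.IsKKT α x lam) {u : EuclideanSpace ℝ (Fin n)}
    (hu : u ∈ P.admissible α x) :
    0 ≤ inner ℝ (P.constraintGradient x lam)
      (u - (P.constraintGradient x lam - gradient P.f x)) := by
  rw [inner_constraintGradient]
  apply add_nonneg
  · refine (Finset.sum_eq_zero fun j _ => ?_).ge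
    have h1 := hu.1 j
    have h2 := h.mem_admissible.1 j
    rw [inner_sub_right]
    have : inner ℝ (gradient (P.h j) x) u - inner ℝ (gradient (P.h j) x)
      (P.constraintGradient x lam - gradient P.f x) = 0 := by linarith
    rw [this, mul_zero]
  · refine Finset.sum_nonneg fun i _ => ?_
    have h2 := h.complementary i
    rw [inner_sub_right]
    by_cases hi : i ∈ P.active x
    · have h3 := mul_nonneg (h.mem_multipliers.1 i) (hu.2 i hi)
      linarith
    · rw [h.mem_multipliers.2 i hi, zero_mul]

/-- The obtuse-angle property of projections; it gives existence and uniqueness of the minimizer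
selected by `velocity`. -/
theorem norm_sq_add_le (h : P.IsKKT α x lam) {u : EuclideanSpace ℝ (Fin n)}
    (hu : u ∈ P.admissible α x) :
    ‖P.constraintGradient x lam‖ ^ 2 +
      ‖u - (P.constraintGradient x lam - gradient P.f x)‖ ^ 2 ≤ ‖u + gradient P.f x‖ ^ 2 := by
  have h1 := h.inner_nonneg hu
  have h2 : u + gradient P.f x = P.constraintGradient x lam +
    (u - (P.constraintGradient x lam - gradient P.f x)) := by abel
  rw [h2, norm_add_sq_real]
  linarith

theorem velocity_eq (h : P.IsKKT α x lam) :
    P.velocity α x = P.constraintGradient x lam - gradient P.f x := by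
  have hex : ∃ v, v ∈ P.admissible α x ∧
      IsMinOn (fun u => (1 / 2 : ℝ) * ‖u + gradient P.f x‖ ^ 2) (P.admissible α x) v := by
    refine ⟨_, h.mem_admissible, fun u hu => ?_⟩
    have h1 := h.norm_sq_add_le hu
    have h2 := sq_nonneg ‖u - (P.constraintGradient x lam - gradient P.f x)‖
    simp only [Set.mem_ofPred_eq, sub_add_cancel]
    linarith
  obtain ⟨hmem, hmin⟩ := Classical.epsilon_spec hex
  have h1 := h.norm_sq_add_le hmem
  have h2 := hmin h.mem_admissible
  simp only [Set.mem_ofPred_eq, sub_add_cancel] at h2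
  rw [← sub_eq_zero, ← norm_eq_zero, ← sq_eq_zero_iff]
  exact le_antisymm (by unfold velocity; linarith) (sq_nonneg _)

theorem mem_subdifferential_iff (h : P.IsKKT α x lam) {v R : EuclideanSpace ℝ (Fin n)}
    (hv : v = R - gradient P.f x) :
    -R ∈ subdifferential (convexIndicator (P.admissible α x)) v ↔ v = P.velocity α x := by
  rw [h.velocity_eq]
  constructor
  · intro hR
    have hvV : v ∈ P.admissible α x := by
      by_contra hvn
      have := hR v
      simp [convexIndicator, hvn] at this
    have h1 := hR (P.constraintGradient x lam - gradient P.f x)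
    simp only [convexIndicator, if_pos hvV, if_pos h.mem_admissible, sub_zero, inner_neg_left] at h1
    have h2 : -inner ℝ R (P.constraintGradient x lam - gradient P.f x - v) ≤ (0 : ℝ) := by
      exact_mod_cast h1
    have h3 := h.inner_nonneg hvV
    set w := P.constraintGradient x lam - gradient P.f x with hw
    have h4 : P.constraintGradient x lam = R + (w - v) := by rw [hw, hv]; abel
    rw [h4, ← neg_sub w v, inner_neg_right, inner_add_left, real_inner_self_eq_norm_sq] at h3
    have h5 : ‖w - v‖ ^ 2 = 0 := le_antisymm (by linarith) (sq_nonneg _)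
    exact (sub_eq_zero.1 (norm_eq_zero.1 (sq_eq_zero_iff.1 h5))).symm
  · intro hvw y
    have hR : R = P.constraintGradient x lam := by
      rw [hv] at hvw
      exact sub_left_injective hvw
    have hvV : v ∈ P.admissible α x := hvw ▸ h.mem_admissible
    by_cases hy : y ∈ P.admissible α x
    · simp only [convexIndicator, if_pos hvV, if_pos hy, sub_zero, inner_neg_left]
      have := h.inner_nonneg hy
      rw [← hvw, ← hR] at this
      have h6 : -inner ℝ R (y - v) ≤ (0 : ℝ) := by linarith
      exact_mod_cast h6
    · simp [convexIndicator, hvV, hy]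

end IsKKT

theorem isIterates_iff {α T : ℝ} (hT : 0 < T)
    {lam : EuclideanSpace ℝ (Fin n) → (Fin nh → ℝ) × (Fin ng → ℝ)}
    (hlam : ∀ x, P.IsKKT α x (lam x)) {x : ℕ → EuclideanSpace ℝ (Fin n)} :
    P.IsIterates α T x ↔ ∀ k, x (k + 1) = x k + T • P.velocity α (x k) := by
  constructor
  · rintro ⟨R, hR⟩ k
    have hv : T⁻¹ • (x (k + 1) - x k) = R k - gradient P.f (x k) := by
      rw [(hR k).1, sub_add, sub_sub_cancel_left, ← smul_sub, ← smul_neg, smul_smul,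
        inv_mul_cancel₀ hT.ne', one_smul, neg_sub]
    rw [← ((hlam (x k)).mem_subdifferential_iff hv).1 (hR k).2, smul_smul,
      mul_inv_cancel₀ hT.ne', one_smul, add_sub_cancel]
  · intro h
    refine ⟨fun k => P.velocity α (x k) + gradient P.f (x k), fun k => ⟨?_, ?_⟩⟩
    · rw [h k, smul_add]
      abel
    · have hv : T⁻¹ • (x (k + 1) - x k) = P.velocity α (x k) := by
        rw [h k, add_sub_cancel_left, smul_smul, inv_mul_cancel₀ hT.ne', one_smul]
      refine ((hlam (x k)).mem_subdifferential_iff ?_).2 hv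
      rw [hv, add_sub_cancel_right]

theorem existsUnique_isIterates {α T : ℝ} (hT : 0 < T)
    {lam : EuclideanSpace ℝ (Fin n) → (Fin nh → ℝ) × (Fin ng → ℝ)}
    (hlam : ∀ x, P.IsKKT α x (lam x)) (x₀ : EuclideanSpace ℝ (Fin n)) :
    ∃! x : ℕ → EuclideanSpace ℝ (Fin n), P.IsIterates α T x ∧ x 0 = x₀ := by
  simp only [isIterates_iff hT hlam]
  refine ⟨fun k => Nat.rec x₀ (fun _ y => y + T • P.velocity α y) k, ⟨fun k => rfl, rfl⟩, ?_⟩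
  rintro y ⟨hy, hy0⟩
  funext k
  induction k with
  | zero => exact hy0
  | succ k ih => rw [hy k, ih]

end ConstrainedProblem

/-! ### Monotone dual values and convergence to the minimizer. -/

namespace ConstrainedProblem

variable {n ng nh : ℕ} {P : ConstrainedProblem n ng nh}

/-- A trajectory `x` of constrained gradient descent, with its velocities `v` and multipliers
`lam`. -/
structure IsDescentPath (P : ConstrainedProblem n ng nh) (α μ L T : ℝ)
    (x v : ℕ → EuclideanSpace ℝ (Fin n)) (lam : ℕ → (Fin nh → ℝ) × (Fin ng → ℝ)) : Prop where
  standing : P.Standing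
  convexity : P.Convexity μ
  alpha_pos : 0 < α
  alpha_lt : α < μ
  step_pos : 0 < T
  mu_le : μ ≤ L
  step_mul_le : T * (L + μ) ≤ 2
  dual : ∀ k, P.IsDualSolution α (x k) (lam k)
  smooth : ∀ k y z, ‖gradient (P.lagrangian (lam k)) y - gradient (P.lagrangian (lam k)) z‖ ≤
    L * ‖y - z‖
  velocity_eq : ∀ k, v k = P.constraintGradient (x k) (lam k) - gradient P.f (x k)
  step : ∀ k, x (k + 1) = x k + T • v k

namespace IsDescentPath

variable {α μ L T : ℝ} {x v : ℕ → EuclideanSpace ℝ (Fin n)}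
  {lam : ℕ → (Fin nh → ℝ) × (Fin ng → ℝ)} (hp : P.IsDescentPath α μ L T x v lam)
include hp

theorem kkt (k : ℕ) : P.IsKKT α (x k) (lam k) :=
  (hp.dual k).isKKT hp.standing hp.alpha_pos

theorem lam_nonneg (k : ℕ) (i : Fin ng) : 0 ≤ (lam k).2 i :=
  (hp.kkt k).mem_multipliers.1 i

theorem velocity_mem (k : ℕ) : v k ∈ P.admissible α (x k) := by
  rw [hp.velocity_eq]
  exact (hp.kkt k).mem_admissible

theorem mu_mul_step_le : μ * T ≤ 1 := by
  nlinarith [hp.mu_le, hp.step_mul_le, hp.step_pos]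

theorem alpha_mul_step_lt : α * T < μ * T :=
  mul_lt_mul_of_pos_right hp.alpha_lt hp.step_pos

theorem rate_pos : 0 < 1 - α * T := by
  linarith [hp.alpha_mul_step_lt, hp.mu_mul_step_le]

theorem rate_lt_one : 1 - α * T < 1 := by
  linarith [mul_pos hp.alpha_pos hp.step_pos]

theorem sq_rate_lt : (1 - μ * T) ^ 2 < 1 - α * T := by
  have h1 := hp.mu_mul_step_le
  have h2 := hp.alpha_mul_step_lt
  have h3 := mul_pos hp.convexity.mu_pos hp.step_pos
  nlinarith

theorem sub_eq (k : ℕ) : x (k + 1) - x k = T • v k := by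
  rw [hp.step, add_sub_cancel_left]

theorem gradient_lagrangian_eq (k : ℕ) : gradient (P.lagrangian (lam k)) (x k) = -v k := by
  rw [hp.standing.gradient_lagrangian, hp.velocity_eq, neg_sub]

theorem h_succ (k : ℕ) (j : Fin nh) : P.h j (x (k + 1)) = (1 - α * T) * P.h j (x k) := by
  have h1 := (hp.velocity_mem k).1 j
  rw [hp.convexity.h_eq hp.standing j (x k) (x (k + 1)), hp.sub_eq, real_inner_smul_right]
  linear_combination T * h1

theorem h_eq (k : ℕ) (j : Fin nh) : P.h j (x k) = (1 - α * T) ^ k * P.h j (x 0) := by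
  induction k with
  | zero => simp
  | succ k ih => rw [hp.h_succ, ih, pow_succ]; ring

theorem inner_g_eq {k : ℕ} {i : Fin ng} (hi : 0 < (lam k).2 i) :
    inner ℝ (gradient (P.g i) (x k)) (v k) = -(α * P.g i (x k)) := by
  have h := (hp.kkt k).complementary i
  rw [← hp.velocity_eq] at h
  have := (mul_eq_zero.1 h).resolve_left hi.ne'
  linarith

theorem g_nonpos {k : ℕ} {i : Fin ng} (hi : 0 < (lam k).2 i) : P.g i (x k) ≤ 0 := by
  by_contra hn
  exact hi.ne' ((hp.kkt k).mem_multipliers.2 i hn)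

theorem g_succ_le {k : ℕ} {i : Fin ng} (hi : 0 < (lam k).2 i) :
    P.g i (x (k + 1)) ≤ (1 - α * T) * P.g i (x k) := by
  have h1 := (hp.convexity.concave_g i).le_add_inner_gradient
    (hp.standing.smooth_g i).differentiable (x k) (x (k + 1))
  rw [hp.sub_eq, real_inner_smul_right, hp.inner_g_eq hi] at h1
  linarith

theorem g_succ_nonpos {k : ℕ} {i : Fin ng} (hi : 0 < (lam k).2 i) : P.g i (x (k + 1)) ≤ 0 :=
  (hp.g_succ_le hi).trans (mul_nonpos_of_nonneg_of_nonpos hp.rate_pos.le (hp.g_nonpos hi))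

theorem mem_multipliers_succ (k : ℕ) : lam k ∈ P.multipliers (x (k + 1)) := by
  refine ⟨hp.lam_nonneg k, fun i hi => ?_⟩
  by_contra hne
  exact hi (hp.g_succ_nonpos (lt_of_le_of_ne (hp.lam_nonneg k i) (Ne.symm hne)))

theorem strongConvex (k : ℕ) (y z : EuclideanSpace ℝ (Fin n)) :
    P.lagrangian (lam k) y + inner ℝ (gradient (P.lagrangian (lam k)) y) (z - y) +
      μ / 2 * ‖z - y‖ ^ 2 ≤ P.lagrangian (lam k) z :=
  (hp.convexity.strongConvexOn_lagrangian (hp.lam_nonneg k)).add_inner_gradient_le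
    (hp.standing.differentiable_lagrangian _) y z

theorem contraction (k : ℕ) (y z : EuclideanSpace ℝ (Fin n)) :
    ‖y - z - T • (gradient (P.lagrangian (lam k)) y - gradient (P.lagrangian (lam k)) z)‖ ≤
      (1 - μ * T) * ‖y - z‖ :=
  (hp.convexity.strongConvexOn_lagrangian (hp.lam_nonneg k)).norm_gradient_step_sub_le
    (hp.standing.differentiable_lagrangian _) (hp.smooth k) hp.mu_le hp.step_pos hp.step_mul_le y z

/-- The contraction is applied to the pair `x (k + 1)`, `x k`, whose images under the gradient step
differ by `-T ∇ₓ l(x (k + 1), lam k)`. -/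
theorem norm_gradient_succ_le (k : ℕ) :
    ‖gradient (P.lagrangian (lam k)) (x (k + 1))‖ ≤ (1 - μ * T) * ‖v k‖ := by
  have h := hp.contraction k (x (k + 1)) (x k)
  rw [hp.gradient_lagrangian_eq, hp.sub_eq, sub_neg_eq_add, smul_add, sub_add_cancel_right,
    norm_neg, norm_smul, norm_smul, Real.norm_of_nonneg hp.step_pos.le] at h
  refine le_of_mul_le_mul_left ?_ hp.step_pos
  linarith

/-- The optimal dual value increases along the trajectory. -/
theorem dualObjective_add_le (k : ℕ) :
    P.dualObjective α (x k) (lam k) + T * (1 - μ * T / 2) * (μ / α - 1) * ‖v k‖ ^ 2 ≤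
      P.dualObjective α (x (k + 1)) (lam (k + 1)) := by
  refine le_trans ?_ ((hp.dual (k + 1)).2 (hp.mem_multipliers_succ k))
  have h1 := hp.strongConvex k (x k) (x (k + 1))
  rw [hp.gradient_lagrangian_eq, hp.sub_eq, inner_neg_left, real_inner_smul_right,
    real_inner_self_eq_norm_sq, norm_smul, mul_pow, Real.norm_eq_abs, sq_abs] at h1
  have h2 := pow_le_pow_left₀ (norm_nonneg _) (hp.norm_gradient_succ_le k) 2
  have hα := hp.alpha_pos
  have h3 := mul_le_mul_of_nonneg_left h2 (by positivity : 0 ≤ 1 / (2 * α))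
  have h4 : 1 / (2 * α) * ((1 - μ * T) * ‖v k‖) ^ 2 = 1 / (2 * α) * ‖v k‖ ^ 2 -
      T * (1 - μ * T / 2) * (μ / α) * ‖v k‖ ^ 2 := by
    field_simp
    ring
  rw [h4] at h3
  simp only [dualObjective, hp.gradient_lagrangian_eq, norm_neg]
  nlinarith

theorem lagrangian_le {y : EuclideanSpace ℝ (Fin n)} (hy : y ∈ P.feasibleSet) (k : ℕ) :
    P.lagrangian (lam k) y ≤ P.f y := by
  have h1 : ∑ j, (lam k).1 j * P.h j y = 0 :=
    Finset.sum_eq_zero fun j _ => by rw [hy.2 j, mul_zero]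
  have h2 : 0 ≤ ∑ i, (lam k).2 i * P.g i y :=
    Finset.sum_nonneg fun i _ => mul_nonneg (hp.lam_nonneg k i) (hy.1 i)
  simp only [lagrangian]
  linarith

theorem lagrangian_add_le {y : EuclideanSpace ℝ (Fin n)} (hy : y ∈ P.feasibleSet) (k : ℕ) :
    P.lagrangian (lam k) (x k) + inner ℝ (v k) (x k - y) + μ / 2 * ‖x k - y‖ ^ 2 ≤ P.f y := by
  have h1 := hp.strongConvex k (x k) y
  rw [hp.gradient_lagrangian_eq, inner_neg_left, ← inner_neg_right, neg_sub, norm_sub_rev] at h1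
  exact h1.trans (hp.lagrangian_le hy k)

/-- Weak duality: the cross term is removed by completing the square, which costs `α / 2 * ‖x k - y‖
^ 2` and is paid for by strong convexity. -/
theorem dualObjective_le {y : EuclideanSpace ℝ (Fin n)} (hy : y ∈ P.feasibleSet) (k : ℕ) :
    P.dualObjective α (x k) (lam k) ≤ P.f y := by
  refine le_trans ?_ (hp.lagrangian_add_le hy k)
  have hα := hp.alpha_pos
  have h1 : 0 ≤ ‖(1 / α) • v k + (x k - y)‖ ^ 2 := sq_nonneg _
  rw [norm_add_sq_real, real_inner_smul_left, norm_smul, mul_pow, Real.norm_eq_abs, sq_abs] at h1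
  have h2 := mul_le_mul_of_nonneg_left h1 (by positivity : 0 ≤ α / 2)
  have h3 : α / 2 * ((1 / α) ^ 2 * ‖v k‖ ^ 2 + 2 * (1 / α * inner ℝ (v k) (x k - y)) +
      ‖x k - y‖ ^ 2) = 1 / (2 * α) * ‖v k‖ ^ 2 + inner ℝ (v k) (x k - y) +
        α / 2 * ‖x k - y‖ ^ 2 := by
    field_simp
  rw [h3] at h2
  have h4 : α / 2 * ‖x k - y‖ ^ 2 ≤ μ / 2 * ‖x k - y‖ ^ 2 := by
    have := hp.alpha_lt
    gcongr
  simp only [dualObjective, hp.gradient_lagrangian_eq, norm_neg]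
  linarith

theorem gain_pos : 0 < T * (1 - μ * T / 2) * (μ / α - 1) := by
  have h1 := hp.mu_mul_step_le
  have h2 : 1 < μ / α := (one_lt_div hp.alpha_pos).2 hp.alpha_lt
  exact mul_pos (mul_pos hp.step_pos (by linarith)) (by linarith)

theorem monotone_dualObjective : Monotone fun k => P.dualObjective α (x k) (lam k) :=
  monotone_nat_of_le_succ fun k => by
    have := hp.dualObjective_add_le k
    have := mul_nonneg hp.gain_pos.le (sq_nonneg ‖v k‖)
    linarith

theorem tendsto_velocity : Tendsto v atTop (𝓝 0) := by
  obtain ⟨y, hy⟩ := hp.standing.feasible_nonempty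
  have hlim := tendsto_atTop_ciSup hp.monotone_dualObjective
    ⟨P.f y, by rintro _ ⟨k, rfl⟩; exact hp.dualObjective_le hy k⟩
  have hdiff := (hlim.comp (tendsto_add_atTop_nat 1)).sub hlim
  rw [sub_self] at hdiff
  have hg := hp.gain_pos
  have hsq : Tendsto (fun k => ‖v k‖ ^ 2) atTop (𝓝 0) := by
    refine squeeze_zero (fun k => sq_nonneg _) (fun k => ?_)
      (by simpa using hdiff.div_const (T * (1 - μ * T / 2) * (μ / α - 1)))
    rw [le_div_iff₀ hg]
    have := hp.dualObjective_add_le k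
    linarith
  rw [tendsto_zero_iff_norm_tendsto_zero]
  have := (Real.continuous_sqrt.tendsto 0).comp hsq
  rw [Real.sqrt_zero] at this
  refine this.congr fun k => ?_
  simp [Real.sqrt_sq (norm_nonneg _)]

theorem isBounded_range : Bornology.IsBounded (Set.range x) := by
  obtain ⟨y, hy⟩ := hp.standing.feasible_nonempty
  obtain ⟨B, hB⟩ := (hp.tendsto_velocity.norm).bddAbove_range
  have hμ := hp.convexity.mu_pos
  set c := P.f y - P.dualObjective α (x 0) (lam 0) with hc
  have hbound : ∀ k, ‖x k - y‖ ^ 2 ≤ 4 / μ * (B ^ 2 / μ + c) := by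
    intro k
    have hvB : ‖v k‖ ≤ B := hB ⟨k, rfl⟩
    have h1 := hp.lagrangian_add_le hy k
    have h2 := hp.monotone_dualObjective (Nat.zero_le k)
    have h3 : P.dualObjective α (x k) (lam k) ≤ P.lagrangian (lam k) (x k) := by
      have hα := hp.alpha_pos
      have : 0 ≤ 1 / (2 * α) * ‖gradient (P.lagrangian (lam k)) (x k)‖ ^ 2 := by positivity
      simp only [dualObjective]
      linarith
    have h4 := neg_le_of_abs_le (abs_real_inner_le_norm (v k) (x k - y))
    have h5 : ‖v k‖ * ‖x k - y‖ ≤ B ^ 2 / μ + μ / 4 * ‖x k - y‖ ^ 2 := by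
      have h6 : B * ‖x k - y‖ ≤ B ^ 2 / μ + μ / 4 * ‖x k - y‖ ^ 2 := by
        have : 0 ≤ (B - μ / 2 * ‖x k - y‖) ^ 2 / μ := by positivity
        have h7 : (B - μ / 2 * ‖x k - y‖) ^ 2 / μ =
            B ^ 2 / μ + μ / 4 * ‖x k - y‖ ^ 2 - B * ‖x k - y‖ := by
          field_simp
          ring
        linarith
      exact (mul_le_mul_of_nonneg_right hvB (norm_nonneg _)).trans h6
    have h8 : μ / 4 * ‖x k - y‖ ^ 2 ≤ B ^ 2 / μ + c := by
      simp only at h2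
      linarith
    calc ‖x k - y‖ ^ 2 = 4 / μ * (μ / 4 * ‖x k - y‖ ^ 2) := by field_simp
      _ ≤ _ := mul_le_mul_of_nonneg_left h8 (by positivity)
  refine (Metric.isBounded_closedBall (x := y)
    (r := √(4 / μ * (B ^ 2 / μ + c)))).subset ?_
  rintro _ ⟨k, rfl⟩
  rw [Metric.mem_closedBall, dist_eq_norm]
  exact Real.le_sqrt_of_sq_le (hbound k)

/-- Complementarity expresses the multiplier term through the velocity, so it vanishes in the limit
without any bound on the multipliers. -/
theorem alpha_mul_sum_eq (k : ℕ) :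
    α * ((∑ j, (lam k).1 j * P.h j (x k)) + ∑ i, (lam k).2 i * P.g i (x k)) =
      -inner ℝ (gradient P.f (x k) + v k) (v k) := by
  have h0 : gradient P.f (x k) + v k = P.constraintGradient (x k) (lam k) := by
    rw [hp.velocity_eq]; abel
  rw [h0, inner_constraintGradient, mul_add, Finset.mul_sum, Finset.mul_sum, neg_add,
    ← Finset.sum_neg_distrib, ← Finset.sum_neg_distrib]
  congr 1
  · refine Finset.sum_congr rfl fun j _ => ?_
    linear_combination (lam k).1 j * (hp.velocity_mem k).1 j
  · refine Finset.sum_congr rfl fun i _ => ?_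
    have h := (hp.kkt k).complementary i
    rw [← hp.velocity_eq] at h
    linear_combination h

theorem tendsto_minimizer {xs : EuclideanSpace ℝ (Fin n)} (hxs : P.IsMinimizer xs) :
    Tendsto x atTop (𝓝 xs) := by
  apply tendsto_of_subseq_tendsto
  intro ns hns
  obtain ⟨a, -, φ, hφ, ha⟩ := tendsto_subseq_of_bounded (x := x ∘ ns) hp.isBounded_range
    (fun k => Set.mem_range_self _)
  have hy : Tendsto (fun k => ns (φ k)) atTop atTop := hns.comp hφ.tendsto_atTop
  have ha' : Tendsto (fun k => x (ns (φ k))) atTop (𝓝 a) := ha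
  have hv : Tendsto (fun k => v (ns (φ k))) atTop (𝓝 0) := hp.tendsto_velocity.comp hy
  have hS := hp.standing
  have hfeas : a ∈ P.feasibleSet := by
    constructor
    · intro i
      by_contra! hneg
      have hg := ((hS.smooth_g i).differentiable.continuous.tendsto a).comp ha'
      have hgr := ((hS.smooth_g i).continuous_gradient.tendsto a).comp ha'
      have hlim := (hgr.inner (𝕜 := ℝ) hv).add (hg.const_mul α)
      rw [inner_zero_right, zero_add] at hlim
      -- A constraint violated at `a` is active along the subsequence, and its velocity constraint
      -- passes to the limit with `v → 0`.
      have h0 : 0 ≤ α * P.g i a := by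
        refine ge_of_tendsto hlim ?_
        filter_upwards [hg.eventually_lt_const hneg] with k hk
        exact (hp.velocity_mem _).2 i hk.le
      nlinarith [hp.alpha_pos]
    · intro j
      have h1 := ((hS.smooth_h j).differentiable.continuous.tendsto a).comp ha'
      have h2 := ((tendsto_pow_atTop_nhds_zero_of_lt_one hp.rate_pos.le hp.rate_lt_one).mul_const
        (P.h j (x 0))).comp hy
      rw [zero_mul] at h2
      refine tendsto_nhds_unique h1 (h2.congr fun k => ?_)
      exact (hp.h_eq _ j).symm
  have hineq : ∀ k, P.f (x k) + 1 / α * inner ℝ (gradient P.f (x k) + v k) (v k) +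
      inner ℝ (v k) (x k - xs) + μ / 2 * ‖x k - xs‖ ^ 2 ≤ P.f xs := by
    intro k
    have h1 := hp.lagrangian_add_le hxs.1 k
    have h2 := hp.alpha_mul_sum_eq k
    have h3 : (∑ j, (lam k).1 j * P.h j (x k)) + ∑ i, (lam k).2 i * P.g i (x k) =
        -(1 / α * inner ℝ (gradient P.f (x k) + v k) (v k)) := by
      have := hp.alpha_pos.ne'
      rw [← mul_neg, ← h2]
      field_simp
    simp only [lagrangian] at h1
    rw [h3] at h1
    linarith
  have hlim : P.f a + μ / 2 * ‖a - xs‖ ^ 2 ≤ P.f xs := by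
    have hf := (hS.smooth_f.differentiable.continuous.tendsto a).comp ha'
    have hgr := (hS.smooth_f.continuous_gradient.tendsto a).comp ha'
    have hd := ha'.sub_const xs
    have := ((hf.add (((hgr.add hv).inner (𝕜 := ℝ) hv).const_mul (1 / α))).add
      (hv.inner (𝕜 := ℝ) hd)).add ((hd.norm.pow 2).const_mul (μ / 2))
    simp only [inner_zero_right, inner_zero_left, mul_zero, add_zero] at this
    exact le_of_tendsto this (Eventually.of_forall fun k => hineq _)
  have hmin : P.f xs ≤ P.f a := hxs.2 hfeas
  have hμ := hp.convexity.mu_pos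
  have hzero : ‖a - xs‖ ^ 2 = 0 := by
    refine le_antisymm ?_ (sq_nonneg _)
    by_contra! hpos
    have := mul_pos (half_pos hμ) hpos
    linarith
  have hax : a = xs := sub_eq_zero.1 (norm_eq_zero.1 (sq_eq_zero_iff.1 hzero))
  exact ⟨φ, hax ▸ ha'⟩

end IsDescentPath

end ConstrainedProblem

/-! ### Stability of multipliers and the convergence rate. -/

namespace ConstrainedProblem

variable {n ng nh : ℕ} {P : ConstrainedProblem n ng nh}

theorem MFCQ.eq_zero_of_constraintGradient_eq_zero {x : EuclideanSpace ℝ (Fin n)} (h : P.MFCQ x)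
    {κ : (Fin nh → ℝ) × (Fin ng → ℝ)} (hκ : κ ∈ P.multipliers x)
    (h0 : P.constraintGradient x κ = 0) : κ = 0 := by
  obtain ⟨hli, w, hwh, hwg⟩ := h
  have h1 := inner_constraintGradient (P := P) x w κ
  simp only [h0, inner_zero_left, hwh, mul_zero, Finset.sum_const_zero, zero_add] at h1
  have hterm : ∀ i, 0 ≤ κ.2 i * inner ℝ (gradient (P.g i) x) w := fun i => by
    by_cases hi : i ∈ P.active x
    · exact mul_nonneg (hκ.1 i) (hwg i hi).le
    · rw [hκ.2 i hi, zero_mul]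
  have hκ2 : κ.2 = 0 := by
    funext i
    have hi := (Finset.sum_eq_zero_iff_of_nonneg fun i _ => hterm i).1 h1.symm i (Finset.mem_univ i)
    by_cases hia : i ∈ P.active x
    · exact (mul_eq_zero.1 hi).resolve_right (hwg i hia).ne'
    · exact hκ.2 i hia
  have hκ1 : κ.1 = 0 := by
    rw [constraintGradient_apply, hκ2] at h0
    simp only [Pi.zero_apply, zero_smul, Finset.sum_const_zero, add_zero] at h0
    funext j
    exact Fintype.linearIndependent_iff.1 hli κ.1 h0 j
  exact Prod.ext hκ1 hκ2

theorem MFCQ.exists_multiplier_near {x : EuclideanSpace ℝ (Fin n)} (h : P.MFCQ x)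
    (c : EuclideanSpace ℝ (Fin n)) :
    ∃ C : ℝ, 0 ≤ C ∧ ∃ δ : ℝ, 0 < δ ∧ ∀ lam ∈ P.multipliers x,
      ‖P.constraintGradient x lam - c‖ ≤ δ → ∃ lam' : (Fin nh → ℝ) × (Fin ng → ℝ),
        P.constraintGradient x lam' = c ∧ (∀ i, 0 ≤ lam'.2 i) ∧
        (∀ i, lam'.2 i ≤ (1 + C * ‖P.constraintGradient x lam - c‖) * lam.2 i) ∧
        ‖lam' - lam‖ ≤ C * ‖P.constraintGradient x lam - c‖ := by
  classical
  obtain ⟨C, hC, δ, hδ, hsol⟩ := exists_nonneg_solution_near (P.constraintGradient x) c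
    (Finset.univ.filter fun i => i ∈ P.active x) fun κ hS h0 =>
      h.eq_zero_of_constraintGradient_eq_zero ⟨h0, fun i hi => hS i (by simpa using hi)⟩
  exact ⟨C, hC, δ, hδ, fun lam hlam => hsol lam (fun i hi => hlam.2 i (by simpa using hi)) hlam.1⟩

/-- With target `0` the nearby exact solution can only be `0`; homogeneity removes the smallness
condition `δ`. -/
theorem MFCQ.exists_norm_le {x : EuclideanSpace ℝ (Fin n)} (h : P.MFCQ x) :
    ∃ C : ℝ, 0 ≤ C ∧ ∀ lam ∈ P.multipliers x, ‖lam‖ ≤ C * ‖P.constraintGradient x lam‖ := by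
  obtain ⟨C, hC, δ, hδ, hsol⟩ := h.exists_multiplier_near 0
  refine ⟨C, hC, fun lam hlam => ?_⟩
  rcases eq_or_ne (P.constraintGradient x lam) 0 with h0 | h0
  · rw [h.eq_zero_of_constraintGradient_eq_zero hlam h0]
    simp
  have hpos := norm_pos_iff.2 h0
  set s := δ / ‖P.constraintGradient x lam‖ with hs
  have hs0 : 0 < s := div_pos hδ hpos
  have hnorm : ‖P.constraintGradient x (s • lam)‖ = s * ‖P.constraintGradient x lam‖ := by
    rw [map_smul, norm_smul, Real.norm_of_nonneg hs0.le]
  have hmem : s • lam ∈ P.multipliers x :=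
    ⟨fun i => mul_nonneg hs0.le (hlam.1 i), fun i hi => by simp [hlam.2 i hi]⟩
  obtain ⟨lam', h1, h2, h3, h4⟩ := hsol _ hmem (by
    rw [sub_zero, hnorm, hs, div_mul_cancel₀ _ hpos.ne'])
  have hz : lam' = 0 := h.eq_zero_of_constraintGradient_eq_zero ⟨h2, fun i hi =>
    le_antisymm (by simpa [hlam.2 i hi] using h3 i) (h2 i)⟩ h1
  rw [hz, zero_sub, norm_neg, sub_zero, hnorm, norm_smul, Real.norm_of_nonneg hs0.le] at h4
  exact le_of_mul_le_mul_left (by linarith) hs0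

theorem Standing.exists_le_g (hP : P.Standing) :
    ∃ K : ℝ, 0 ≤ K ∧ ∀ i y z,
      P.g i y + inner ℝ (gradient (P.g i) y) (z - y) - K * ‖z - y‖ ^ 2 ≤ P.g i z := by
  choose K hK0 hK using fun i => (hP.smooth_g i).exists_norm_sub_le
  refine ⟨∑ i, K i, Finset.sum_nonneg fun i _ => hK0 i, fun i y z => ?_⟩
  refine le_trans ?_ (add_inner_gradient_sub_le_of_lipschitz (hP.smooth_g i).differentiable
    (hK i) y z)
  have h1 : K i / 2 ≤ ∑ i, K i := by
    have := Finset.single_le_sum (fun i _ => hK0 i) (Finset.mem_univ i)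
    linarith [hK0 i]
  have := mul_le_mul_of_nonneg_right h1 (sq_nonneg ‖z - y‖)
  linarith

namespace IsDescentPath

variable {α μ L T : ℝ} {x v : ℕ → EuclideanSpace ℝ (Fin n)}
  {lam : ℕ → (Fin nh → ℝ) × (Fin ng → ℝ)} (hp : P.IsDescentPath α μ L T x v lam)
include hp

theorem eventually_mem_multipliers {xs : EuclideanSpace ℝ (Fin n)}
    (hx : Tendsto x atTop (𝓝 xs)) : ∀ᶠ k in atTop, lam k ∈ P.multipliers xs := by
  have h : ∀ᶠ k in atTop, ∀ i, i ∉ P.active xs → (lam k).2 i = 0 := by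
    rw [eventually_all]
    intro i
    by_cases hi : i ∈ P.active xs
    · exact Eventually.of_forall fun k h => absurd hi h
    · have hg := ((hp.standing.smooth_g i).differentiable.continuous.tendsto xs).comp hx
      filter_upwards [hg.eventually_const_lt (not_le.1 hi)] with k hk _
      exact (hp.kkt k).mem_multipliers.2 i (not_le.2 hk)
  exact h.mono fun k hk => ⟨hp.lam_nonneg k, hk⟩

theorem eventually_norm_le {xs : EuclideanSpace ℝ (Fin n)} (hx : Tendsto x atTop (𝓝 xs)) :
    ∃ M : ℝ, 0 ≤ M ∧ ∀ᶠ k in atTop, ‖lam k‖ ≤ M := by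
  obtain ⟨C, hC, hbound⟩ := (hp.standing.mfcq xs).exists_norm_le
  obtain ⟨K, hK0, hK⟩ := hp.standing.exists_norm_constraintGradient_sub_le
  have hgr := ((hp.standing.smooth_f.continuous_gradient.tendsto xs).comp hx).add
    hp.tendsto_velocity
  have hr := (tendsto_iff_norm_sub_tendsto_zero.1 hx).const_mul (C * K)
  rw [mul_zero] at hr
  refine ⟨2 * C * (‖gradient P.f xs + 0‖ + 1), by positivity, ?_⟩
  filter_upwards [hp.eventually_mem_multipliers hx, hgr.norm.eventually_le_const (lt_add_one _),
    hr.eventually_le_const (by norm_num : (0 : ℝ) < 1 / 2)] with k h1 h2 h3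
  have h4 := hbound _ h1
  have h5 : ‖P.constraintGradient xs (lam k)‖ ≤
      ‖gradient P.f (x k) + v k‖ + K * ‖x k - xs‖ * ‖lam k‖ := by
    have h0 : P.constraintGradient xs (lam k) = (gradient P.f (x k) + v k) -
        (P.constraintGradient (x k) (lam k) - P.constraintGradient xs (lam k)) := by
      rw [hp.velocity_eq]; abel
    rw [h0]
    exact (norm_sub_le _ _).trans (by gcongr; exact hK _ _ _)
  have h6 := h4.trans (mul_le_mul_of_nonneg_left h5 hC)
  have h7 := mul_le_mul_of_nonneg_right h3 (norm_nonneg (lam k))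
  have h8 := mul_le_mul_of_nonneg_left h2 hC
  simp only [Function.comp_apply] at h8
  linarith

/-- Near its limit `xs`, the multipliers of the trajectory are close to multipliers of `xs` with
no larger support. -/
theorem eventually_exists_multiplier {xs : EuclideanSpace ℝ (Fin n)}
    (hxs : xs ∈ P.feasibleSet) (hx : Tendsto x atTop (𝓝 xs)) :
    ∃ M : ℝ, 0 ≤ M ∧ ∃ η : ℕ → ℝ, (∀ k, 0 ≤ η k) ∧
      (∀ k, η k ≤ M * (‖x k - xs‖ + ‖x (k + 1) - xs‖)) ∧
      ∀ᶠ k in atTop, (∀ i, 0 < (lam k).2 i → P.g i xs = 0) ∧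
        ∃ lam' : (Fin nh → ℝ) × (Fin ng → ℝ),
          P.constraintGradient xs lam' = gradient P.f xs ∧ (∀ i, 0 ≤ lam'.2 i) ∧
          (∀ i, lam'.2 i ≤ (1 + η k) * (lam k).2 i) ∧ ‖lam' - lam k‖ ≤ η k ∧ ‖lam'‖ ≤ M := by
  obtain ⟨C, hC, δ, hδ, hsol⟩ := (hp.standing.mfcq xs).exists_multiplier_near (gradient P.f xs)
  obtain ⟨M, hM0, hM⟩ := hp.eventually_norm_le hx
  have hT := hp.step_pos
  have hL : 0 ≤ L := hp.convexity.mu_pos.le.trans hp.mu_le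
  have hp1 : ∀ k, ‖P.constraintGradient xs (lam k) - gradient P.f xs‖ ≤
      ‖v k‖ + L * ‖x k - xs‖ := by
    intro k
    have h2 := hp.smooth k (x k) xs
    rw [hp.gradient_lagrangian_eq, hp.standing.gradient_lagrangian] at h2
    have h3 : P.constraintGradient xs (lam k) - gradient P.f xs = v k +
        (-v k - (gradient P.f xs - P.constraintGradient xs (lam k))) := by abel
    rw [h3]
    exact (norm_add_le _ _).trans (by gcongr)
  have hη : ∀ k, C * ‖P.constraintGradient xs (lam k) - gradient P.f xs‖ ≤
      C * (1 / T + L) * (‖x k - xs‖ + ‖x (k + 1) - xs‖) := by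
    intro k
    have h1 := hp1 k
    have h2 : ‖v k‖ ≤ 1 / T * (‖x k - xs‖ + ‖x (k + 1) - xs‖) := by
      have h3 : T * ‖v k‖ ≤ ‖x (k + 1) - xs‖ + ‖x k - xs‖ := by
        have h4 : ‖T • v k‖ = T * ‖v k‖ := by rw [norm_smul, Real.norm_of_nonneg hT.le]
        rw [← h4, ← hp.sub_eq, ← sub_sub_sub_cancel_right _ _ xs]
        exact norm_sub_le _ _
      rw [one_div, inv_mul_eq_div, le_div_iff₀ hT]
      linarith
    have h5 : L * ‖x k - xs‖ ≤ L * (‖x k - xs‖ + ‖x (k + 1) - xs‖) :=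
      mul_le_mul_of_nonneg_left (by linarith [norm_nonneg (x (k + 1) - xs)]) hL
    rw [mul_assoc]
    refine mul_le_mul_of_nonneg_left ?_ hC
    linarith
  have hpk : Tendsto (fun k => ‖P.constraintGradient xs (lam k) - gradient P.f xs‖) atTop (𝓝 0) := by
    refine squeeze_zero (fun k => norm_nonneg _) hp1 ?_
    simpa using hp.tendsto_velocity.norm.add
      ((tendsto_iff_norm_sub_tendsto_zero.1 hx).const_mul L)
  refine ⟨max (M + C * δ) (C * (1 / T + L)), le_max_of_le_left (by positivity),
    fun k => C * ‖P.constraintGradient xs (lam k) - gradient P.f xs‖, fun k => by positivity,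
    fun k => (hη k).trans ?_, ?_⟩
  · exact mul_le_mul_of_nonneg_right (le_max_right _ _) (by positivity)
  filter_upwards [hp.eventually_mem_multipliers hx, hM, hpk.eventually_le_const hδ] with k h1 h2 h3
  refine ⟨fun i hi => ?_, ?_⟩
  · by_contra hne
    exact hi.ne' (h1.2 i fun hle : P.g i xs ≤ 0 => hne (le_antisymm hle (hxs.1 i)))
  · obtain ⟨lam', a1, a2, a3, a4⟩ := hsol _ h1 h3
    refine ⟨lam', a1, a2, a3, a4, le_max_of_le_left ?_⟩
    have h5 := norm_le_norm_add_norm_sub (lam k) lam'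
    rw [norm_sub_rev] at h5
    have h6 := mul_le_mul_of_nonneg_left h3 hC
    linarith

/-- The distance to the minimizer decays at the rate at which constraint violations decay. -/
theorem exists_norm_sq_sub_le {xs : EuclideanSpace ℝ (Fin n)} (hxs : P.IsMinimizer xs) :
    ∃ C : ℝ, 0 < C ∧ ∀ k, ‖x k - xs‖ ^ 2 ≤ C * (1 - α * T) ^ k := by
  have hx := hp.tendsto_minimizer hxs
  obtain ⟨M, hM0, η, hη0, hη, hmult⟩ := hp.eventually_exists_multiplier hxs.1 hx
  obtain ⟨K, hK0, hK⟩ := hp.standing.exists_le_g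
  have hT := hp.step_pos
  set β := 1 - α * T with hβ
  have hβ0 : 0 < β := hp.rate_pos
  have hβ1 : β < 1 := hp.rate_lt_one
  -- First-order decrease of `f` below its optimal value. It is paired with any exact multiplier of
  -- `xs`, so it does not depend on which `lam'` is chosen at step `k`.
  set φ : ℕ → ℝ := fun k => -inner ℝ (gradient P.f xs) (x k - xs) with hφ
  set r : ℕ → ℝ := fun k => ‖x k - xs‖ ^ 2 with hr
  set H := ∑ j, |P.h j (x 0)| with hH
  set G : ℝ := (ng : ℝ) with hG
  have hG0 : 0 ≤ G := Nat.cast_nonneg ng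
  have hH0 : 0 ≤ H := Finset.sum_nonneg fun j _ => abs_nonneg _
  have hr0 : ∀ k, 0 ≤ r k := fun k => sq_nonneg _
  have hhx : ∀ k j, inner ℝ (gradient (P.h j) xs) (x k - xs) = P.h j (x k) := by
    intro k j
    have := hp.convexity.h_eq hp.standing j xs (x k)
    rw [hxs.1.2 j] at this
    linarith
  have hsum : ∀ (κ : (Fin nh → ℝ) × (Fin ng → ℝ)) k,
      |∑ j, κ.1 j * P.h j (x k)| ≤ ‖κ‖ * (H * β ^ k) := by
    intro κ k
    refine (Finset.abs_sum_le_sum_abs _ _).trans ?_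
    rw [hH, Finset.sum_mul, Finset.mul_sum]
    refine Finset.sum_le_sum fun j _ => ?_
    rw [abs_mul, hp.h_eq, abs_mul, abs_of_pos (pow_pos hβ0 k), mul_comm (β ^ k)]
    have : |κ.1 j| ≤ ‖κ‖ := (norm_le_pi_norm κ.1 j).trans (norm_fst_le κ)
    gcongr
  have hq_ge : ∀ i, P.g i xs = 0 → ∀ y, P.g i y ≤ inner ℝ (gradient (P.g i) xs) (y - xs) := by
    intro i hi y
    have := (hp.convexity.concave_g i).le_add_inner_gradient
      (hp.standing.smooth_g i).differentiable xs y
    linarith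
  have hq_le : ∀ i, P.g i xs = 0 → ∀ y,
      inner ℝ (gradient (P.g i) xs) (y - xs) ≤ P.g i y + K * ‖y - xs‖ ^ 2 := by
    intro i hi y
    have := hK i xs y
    linarith
  have hstep_sq : ∀ k, ‖x (k + 1) - x k‖ ^ 2 ≤ 2 * (r k + r (k + 1)) := by
    intro k
    have h1 : x (k + 1) - x k = (x (k + 1) - xs) - (x k - xs) := by abel
    have h2 := parallelogram_law_with_norm ℝ (x (k + 1) - xs) (x k - xs)
    rw [h1]
    simp only [hr]
    nlinarith [mul_self_nonneg ‖x (k + 1) - xs + (x k - xs)‖]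
  have hφ_eq : ∀ lam' : (Fin nh → ℝ) × (Fin ng → ℝ),
      P.constraintGradient xs lam' = gradient P.f xs → ∀ k,
      φ k = -(∑ j, lam'.1 j * P.h j (x k)) -
        ∑ i, lam'.2 i * inner ℝ (gradient (P.g i) xs) (x k - xs) := by
    intro lam' h k
    simp only [hφ, ← h, inner_constraintGradient, hhx]
    ring
  have hcard : ∀ (F : Fin ng → ℝ) (c : ℝ), (∀ i, F i ≤ c) → ∑ i, F i ≤ G * c := by
    intro F c h
    refine (Finset.sum_le_sum fun i _ => h i).trans_eq ?_
    simp [hG]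
  have hle_M : ∀ (κ : (Fin nh → ℝ) × (Fin ng → ℝ)) (B : ℝ), ‖κ‖ ≤ B → ∀ i, |κ.2 i| ≤ B :=
    fun κ B h i => ((norm_le_pi_norm κ.2 i).trans (norm_snd_le κ)).trans h
  have hsupp : ∀ (k : ℕ) (lam' : (Fin nh → ℝ) × (Fin ng → ℝ)), (∀ i, 0 ≤ lam'.2 i) →
      (∀ i, lam'.2 i ≤ (1 + η k) * (lam k).2 i) → ∀ i, lam'.2 i = 0 ∨ 0 < (lam k).2 i := by
    intro k lam' h1 h2 i
    rcases (hp.lam_nonneg k i).eq_or_lt with h | h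
    · left
      refine le_antisymm ?_ (h1 i)
      simpa [← h] using h2 i
    · exact Or.inr h
  refine exists_le_mul_pow_of_eventually hβ0 (exists_le_mul_pow_of_coupled (r := r) (φ := φ)
    (η := fun k => 2 * T * η k) (β := β) (ρ := (1 - μ * T) ^ 2)
    (D := 2 * T * M + (H + M * H) + G * K + 4 * (G * (M * K))) hβ1 (sq_nonneg _) hp.sq_rate_lt
    (by positivity) hr0 (fun k => mul_nonneg (by positivity) (hη0 k)) ?_ ?_ ?_ ?_ ?_)
  · simpa [hr] using (tendsto_iff_norm_sub_tendsto_zero.1 hx).pow 2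
  · refine Eventually.of_forall fun k => ?_
    simp only [hr, Real.sqrt_sq (norm_nonneg _)]
    have h1 : 0 ≤ (H + M * H) + G * K + 4 * (G * (M * K)) := by positivity
    have h2 := mul_nonneg h1 (add_nonneg (norm_nonneg (x k - xs)) (norm_nonneg (x (k + 1) - xs)))
    have h3 := mul_le_mul_of_nonneg_left (hη k) (by positivity : 0 ≤ 2 * T)
    linarith
  · filter_upwards [hmult] with k hk
    obtain ⟨hS, lam', h1, h2, h3, h4, h5⟩ := hk
    set q : Fin ng → ℝ := fun i => inner ℝ (gradient (P.g i) xs) (x (k + 1) - xs) with hq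
    have hη0k := hη0 k
    -- Here `q i ≤ K r`, but `q i` may be negative of first order. If `lam'` exceeds `lam k`, the
    -- relative bound turns the excess into `η * lam'`, and the products `-lam' * q` sum into `φ`;
    -- an absolute bound would not suffice.
    have hterm : ∀ i, (lam k - lam').2 i * q i ≤
        η k * (K * r (k + 1) - lam'.2 i * q i + M * (K * r (k + 1))) := by
      intro i
      have hKr : 0 ≤ K * r (k + 1) := mul_nonneg hK0 (hr0 _)
      have hle : lam'.2 i ≤ M := (le_abs_self _).trans (hle_M lam' M h5 i)
      have habs := hle_M (lam' - lam k) _ h4 i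
      simp only [Prod.snd_sub, Pi.sub_apply] at habs ⊢
      have h0' := h2 i
      have h6 : lam'.2 i * (K * r (k + 1)) ≤ M * (K * r (k + 1)) := by gcongr
      refine le_trans ?_ (mul_le_mul_of_nonneg_left (add_le_add_right h6 _) hη0k)
      rcases (hp.lam_nonneg k i).eq_or_lt with h0 | h0
      · have h7 : lam'.2 i = 0 := (hsupp k lam' h2 h3 i).resolve_right (by rw [← h0]; simp)
        rw [← h0, h7]
        simpa using mul_nonneg hη0k hKr
      · have h8 : 0 ≤ K * r (k + 1) - q i := by
          have := hq_le i (hS i h0) (x (k + 1))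
          have := hp.g_succ_nonpos h0
          simp only [hq, hr]
          linarith
        have h9 : lam'.2 i - (lam k).2 i ≤ η k * (lam k).2 i := by linarith [h3 i]
        rcases le_total (lam'.2 i) ((lam k).2 i) with h10 | h10
        · have h11 := mul_nonneg (sub_nonneg.2 h10) h8
          have h12 := mul_le_mul_of_nonneg_right (neg_le_of_abs_le habs) hKr
          have h13 := mul_nonneg hη0k (mul_nonneg h0' h8)
          linarith
        · have h11 : lam'.2 i - (lam k).2 i ≤ η k * lam'.2 i :=
            h9.trans (mul_le_mul_of_nonneg_left h10 hη0k)
          have h12 := mul_le_mul_of_nonneg_right h11 h8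
          have h13 := mul_nonneg (sub_nonneg.2 h10) hKr
          have h14 := mul_nonneg hη0k hKr
          linarith
    have hpart : -inner ℝ (gradient (P.lagrangian (lam k)) xs) (x (k + 1) - xs) ≤
        η k * (φ (k + 1) + (H + M * H) * β ^ (k + 1) +
          (G * K + G * (M * K)) * r (k + 1)) := by
      have e1 : gradient (P.lagrangian (lam k)) xs = -P.constraintGradient xs (lam k - lam') := by
        rw [hp.standing.gradient_lagrangian, ← h1, map_sub, neg_sub]
      rw [e1, inner_neg_left, neg_neg, inner_constraintGradient, hφ_eq lam' h1 (k + 1)]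
      simp only [hhx]
      have a1 := (le_abs_self _).trans (hsum (lam k - lam') (k + 1))
      have a2 : ‖lam k - lam'‖ * (H * β ^ (k + 1)) ≤ η k * (H * β ^ (k + 1)) := by
        rw [norm_sub_rev]; gcongr
      have a3 := Finset.sum_le_sum fun i (_ : i ∈ Finset.univ) => hterm i
      rw [← Finset.mul_sum, Finset.sum_add_distrib, Finset.sum_sub_distrib, Finset.sum_const,
        Finset.sum_const, Finset.card_univ, Fintype.card_fin, nsmul_eq_mul, nsmul_eq_mul,
        ← hG] at a3
      have a4 := neg_le_of_abs_le (hsum lam' (k + 1))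
      have a5 : ‖lam'‖ * (H * β ^ (k + 1)) ≤ M * (H * β ^ (k + 1)) := by gcongr
      have a6 : 0 ≤ η k * (M * (H * β ^ (k + 1)) - ∑ j, lam'.1 j * P.h j (x (k + 1))) := by
        refine mul_nonneg hη0k ?_
        have := (le_abs_self _).trans (hsum lam' (k + 1))
        linarith
      linarith
    -- The frozen Lagrangian need not be stationary at `xs`; expanding the contraction about `xs`
    -- leaves its gradient there as a cross term.
    have hnorm : r (k + 1) ≤ (1 - μ * T) ^ 2 * r k +
        2 * T * -inner ℝ (gradient (P.lagrangian (lam k)) xs) (x (k + 1) - xs) := by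
      have b1 := hp.contraction k (x k) xs
      have b2 : x k - xs - T • (gradient (P.lagrangian (lam k)) (x k) -
          gradient (P.lagrangian (lam k)) xs) =
          (x (k + 1) - xs) + T • gradient (P.lagrangian (lam k)) xs := by
        rw [hp.gradient_lagrangian_eq, hp.step, smul_sub, smul_neg]
        abel
      rw [b2] at b1
      have b3 := pow_le_pow_left₀ (norm_nonneg _) b1 2
      rw [norm_add_sq_real, mul_pow, real_inner_smul_right, real_inner_comm] at b3
      have b4 := sq_nonneg ‖T • gradient (P.lagrangian (lam k)) xs‖
      simp only [hr]
      linarith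
    have hfin := mul_le_mul_of_nonneg_left hpart (by positivity : 0 ≤ 2 * T)
    have hβk := pow_pos hβ0 (k + 1)
    have c1 : 0 ≤ (2 * T * η k) * ((2 * T * M + G * K + 4 * (G * (M * K))) * β ^ (k + 1)) := by
      positivity
    have c2 : 0 ≤ (2 * T * η k) *
        ((2 * T * M + (H + M * H) + 3 * (G * (M * K))) * r (k + 1)) := by
      have := hr0 (k + 1)
      positivity
    linarith
  · filter_upwards [hmult] with k hk
    obtain ⟨hS, lam', h1, h2, h3, h4, h5⟩ := hk
    rw [hφ_eq lam' h1, hφ_eq lam' h1]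
    have hrk := add_nonneg (hr0 k) (hr0 (k + 1))
    -- On the support the velocity constraint is tight, so `g` is multiplied by `β` up to second
    -- order; replacing `g` by its linearization at `xs` also costs only second-order terms.
    have hterm : ∀ i, β * (lam'.2 i * inner ℝ (gradient (P.g i) xs) (x k - xs)) -
        lam'.2 i * inner ℝ (gradient (P.g i) xs) (x (k + 1) - xs) ≤
          4 * (M * K * (r k + r (k + 1))) := by
      intro i
      rcases hsupp k lam' h2 h3 i with h0 | h0
      · rw [h0]
        simp only [zero_mul, mul_zero, sub_zero]
        positivity
      · have b1 := hq_ge i (hS i h0) (x (k + 1))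
        have b2 := hq_le i (hS i h0) (x k)
        have b3 := hK i (x k) (x (k + 1))
        rw [hp.sub_eq, real_inner_smul_right, hp.inner_g_eq h0, ← hp.sub_eq] at b3
        have b4 := mul_le_mul_of_nonneg_left (hstep_sq k) hK0
        have b5 := mul_le_mul_of_nonneg_left b2 hβ0.le
        have b6 : β * (K * r k) ≤ 1 * (K * (r k + r (k + 1))) := by
          have := hr0 k
          have := hr0 (k + 1)
          gcongr
          linarith
        have b7 : β * inner ℝ (gradient (P.g i) xs) (x k - xs) -
            inner ℝ (gradient (P.g i) xs) (x (k + 1) - xs) ≤ 4 * (K * (r k + r (k + 1))) := by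
          have : 0 ≤ K * (r k + r (k + 1)) := mul_nonneg hK0 hrk
          have b8 : β * P.g i (x k) = P.g i (x k) - T * (α * P.g i (x k)) := by
            rw [hβ]; ring
          simp only [hr] at *
          linarith
        have b9 := mul_le_mul_of_nonneg_left b7 (h2 i)
        have b10 : lam'.2 i * (4 * (K * (r k + r (k + 1)))) ≤ M * (4 * (K * (r k + r (k + 1)))) := by
          have := (le_abs_self _).trans (hle_M lam' M h5 i)
          gcongr
        linarith
    have a1 := hcard _ _ hterm
    rw [Finset.sum_sub_distrib, ← Finset.mul_sum] at a1
    have a2 : ∑ j, lam'.1 j * P.h j (x (k + 1)) = β * ∑ j, lam'.1 j * P.h j (x k) := by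
      rw [Finset.mul_sum]
      refine Finset.sum_congr rfl fun j _ => ?_
      rw [hp.h_succ]
      ring
    have a3 : 0 ≤ (2 * T * M + (H + M * H) + G * K) * (r k + r (k + 1)) := by positivity
    rw [a2]
    linarith
  · filter_upwards [hmult] with k hk
    obtain ⟨hS, lam', h1, h2, h3, h4, h5⟩ := hk
    rw [hφ_eq lam' h1]
    have hrk := hr0 k
    have hterm : ∀ i, lam'.2 i * inner ℝ (gradient (P.g i) xs) (x k - xs) ≤ M * (K * r k) := by
      intro i
      rcases hsupp k lam' h2 h3 i with h0 | h0
      · rw [h0, zero_mul]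
        positivity
      · have b1 := hq_le i (hS i h0) (x k)
        have b2 := hp.g_nonpos h0
        have b3 : lam'.2 i ≤ M := (le_abs_self _).trans (hle_M lam' M h5 i)
        calc _ ≤ lam'.2 i * (K * r k) :=
              mul_le_mul_of_nonneg_left (by simp only [hr]; linarith) (h2 i)
          _ ≤ _ := by gcongr
    have a1 := hcard _ _ hterm
    have a2 := (le_abs_self _).trans (hsum lam' k)
    have a3 : ‖lam'‖ * (H * β ^ k) ≤ M * (H * β ^ k) := by gcongr
    have a4 : 0 ≤ (2 * T * M + H + G * K + 4 * (G * (M * K))) * β ^ k := by positivity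
    have a5 : 0 ≤ (2 * T * M + (H + M * H) + G * K + 3 * (G * (M * K))) * r k := by positivity
    linarith

end IsDescentPath

end ConstrainedProblem

/-! ### Conclusion. -/

theorem StrongConvexOn.le_of_lipschitz_gradient {E : Type*} [NormedAddCommGroup E]
    [InnerProductSpace ℝ E] [CompleteSpace E] [Nontrivial E] {φ : E → ℝ} {μ K : ℝ}
    (hφ : StrongConvexOn Set.univ μ φ) (hd : Differentiable ℝ φ)
    (hK : ∀ y z, ‖gradient φ y - gradient φ z‖ ≤ K * ‖y - z‖) : μ ≤ K := by
  obtain ⟨e, he⟩ := exists_ne (0 : E)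
  have h1 := hφ.add_inner_gradient_le hd 0 e
  have h2 := hφ.add_inner_gradient_le hd e 0
  have h3 := hK e 0
  have h4 := real_inner_le_norm (gradient φ e - gradient φ 0) e
  rw [inner_sub_left] at h4
  simp only [sub_zero, zero_sub, inner_neg_right, norm_neg] at h1 h2 h3
  have hpos : 0 < ‖e‖ := norm_pos_iff.2 he
  have h5 := mul_le_mul_of_nonneg_right h3 hpos.le
  have h6 : μ * ‖e‖ ^ 2 ≤ K * ‖e‖ ^ 2 := by linarith
  exact le_of_mul_le_mul_right h6 (by positivity)

namespace ConstrainedProblem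

variable {n ng nh : ℕ} {P : ConstrainedProblem n ng nh}

theorem Standing.exists_isMinimizer (hP : P.Standing) : ∃ xs, P.IsMinimizer xs := by
  have hclosed : IsClosed P.feasibleSet := by
    have h : P.feasibleSet = (⋂ i, {x | 0 ≤ P.g i x}) ∩ ⋂ j, {x | P.h j x = 0} := by
      ext
      simp [feasibleSet]
    rw [h]
    refine (isClosed_iInter fun i => isClosed_le continuous_const ?_).inter
      (isClosed_iInter fun j => isClosed_eq ?_ continuous_const)
    · exact (hP.smooth_g i).differentiable.continuous
    · exact (hP.smooth_h j).differentiable.continuous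
  have hcomp := Metric.isCompact_of_isClosed_isBounded hclosed hP.feasible_bounded
  obtain ⟨xs, hxs, hmin⟩ := hcomp.exists_isMinOn hP.feasible_nonempty
    hP.smooth_f.differentiable.continuous.continuousOn
  exact ⟨xs, hxs, hmin⟩

theorem IsDescentPath.exists_norm_sq_velocity_le {α μ L T : ℝ}
    {x v : ℕ → EuclideanSpace ℝ (Fin n)} {lam : ℕ → (Fin nh → ℝ) × (Fin ng → ℝ)}
    (hp : P.IsDescentPath α μ L T x v lam) :
    ∃ C : ℝ, 0 < C ∧ ∀ k, ‖v k‖ ^ 2 ≤ C * (1 - α * T) ^ k := by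
  obtain ⟨xs, hxs⟩ := hp.standing.exists_isMinimizer
  obtain ⟨C, hC, hb⟩ := hp.exists_norm_sq_sub_le hxs
  have hT := hp.step_pos
  have hβ := hp.rate_pos
  refine ⟨4 * C / T ^ 2, by positivity, fun k => ?_⟩
  have h1 : ‖T • v k‖ ^ 2 ≤ 2 * (‖x (k + 1) - xs‖ ^ 2 + ‖x k - xs‖ ^ 2) := by
    have e : T • v k = (x (k + 1) - xs) - (x k - xs) := by rw [← hp.sub_eq]; abel
    have h2 := parallelogram_law_with_norm ℝ (x (k + 1) - xs) (x k - xs)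
    rw [e]
    nlinarith [mul_self_nonneg ‖x (k + 1) - xs + (x k - xs)‖]
  have h2 : C * (1 - α * T) ^ (k + 1) ≤ C * (1 - α * T) ^ k :=
    mul_le_mul_of_nonneg_left
      (pow_le_pow_of_le_one hβ.le hp.rate_lt_one.le (Nat.le_succ k)) hC.le
  rw [norm_smul, mul_pow, Real.norm_eq_abs, sq_abs] at h1
  rw [div_mul_eq_mul_div, le_div_iff₀ (by positivity)]
  linarith [hb k, hb (k + 1)]

end ConstrainedProblem

theorem mainTheorem3 {n ng nh : ℕ} (hn : 0 < n) (P : ConstrainedProblem n ng nh)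
    (hP : P.Standing) (μ : ℝ) (hconv : P.Convexity μ)
    (α T Ll : ℝ) (hα : 0 < α) (hαμ : α < μ)
    (lam : EuclideanSpace ℝ (Fin n) → (Fin nh → ℝ) × (Fin ng → ℝ))
    (hlam : ∀ x, P.IsDualSolution α x (lam x))
    (hLl : ∀ x, smoothnessConstant (P.lagrangian (lam x)) ≤ Ll)
    (hT : 0 < T) (hTle : T ≤ 2 / (Ll + μ)) :
    (∀ x₀ : EuclideanSpace ℝ (Fin n),
      ∃! x : ℕ → EuclideanSpace ℝ (Fin n), P.IsIterates α T x ∧ x 0 = x₀) ∧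
    ∀ x : ℕ → EuclideanSpace ℝ (Fin n), P.IsIterates α T x →
      ∃ N : ℕ, 0 < N ∧
        (∃ c₃ : ℝ, 0 < c₃ ∧ ∀ k : ℕ, N ≤ k →
          (1 / 2) * ‖P.velocity α (x (k + 1))‖ ^ 2 ≤
            (1 - 2 * μ * T * (1 - μ * T / 2)) * ((1 / 2) * ‖P.velocity α (x k)‖ ^ 2) +
              c₃ * (1 - α * T) ^ (k - N)) ∧
        (T = 1 / Ll → α = μ / 2 →
          ∀ xs : EuclideanSpace ℝ (Fin n), P.IsMinimizer xs →
            ∃ c₄ : ℝ, ∀ k : ℕ, N ≤ k →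
              ‖x k - xs‖ ^ 2 ≤ c₄ * (1 - μ / (2 * Ll)) ^ k) := by
  have hkkt : ∀ x, P.IsKKT α x (lam x) := fun x => (hlam x).isKKT hP hα
  refine ⟨fun x₀ => ConstrainedProblem.existsUnique_isIterates hT hkkt x₀, fun x hx => ?_⟩
  rw [ConstrainedProblem.isIterates_iff hT hkkt] at hx
  have : Nonempty (Fin n) := ⟨⟨0, hn⟩⟩
  have hμL : μ ≤ Ll := (hconv.strongConvexOn_lagrangian (hlam 0).1.1).le_of_lipschitz_gradient
    (hP.differentiable_lagrangian _) (hP.norm_gradient_lagrangian_sub_le (hLl 0))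
  have hμ := hconv.mu_pos
  have hp : P.IsDescentPath α μ Ll T x (fun k => P.velocity α (x k)) (fun k => lam (x k)) :=
    { standing := hP
      convexity := hconv
      alpha_pos := hα
      alpha_lt := hαμ
      step_pos := hT
      mu_le := hμL
      step_mul_le := (le_div_iff₀ (by linarith)).1 hTle
      dual := fun k => hlam (x k)
      smooth := fun k => hP.norm_gradient_lagrangian_sub_le (hLl (x k))
      velocity_eq := fun k => (hkkt (x k)).velocity_eq
      step := hx }
  -- The bounds hold from the start, so `N = 1` works. In the first claim the geometric term alone
  -- dominates, the contraction term being nonnegative.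
  refine ⟨1, one_pos, ?_, fun hTL hαeq xs hxs => ?_⟩
  · obtain ⟨C, hC, hb⟩ := hp.exists_norm_sq_velocity_le
    refine ⟨C, hC, fun k hk => ?_⟩
    have h1 : (1 - α * T) ^ (k + 1) ≤ (1 - α * T) ^ (k - 1) :=
      pow_le_pow_of_le_one hp.rate_pos.le hp.rate_lt_one.le (by omega)
    have h2 := mul_le_mul_of_nonneg_left h1 hC.le
    have h3 : 0 ≤ (1 - μ * T) ^ 2 * ((1 / 2) * ‖P.velocity α (x k)‖ ^ 2) := by positivity
    have h4 : 1 - 2 * μ * T * (1 - μ * T / 2) = (1 - μ * T) ^ 2 := by ring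
    rw [h4]
    have h5 := hb (k + 1)
    have h6 := sq_nonneg ‖P.velocity α (x (k + 1))‖
    linarith
  · obtain ⟨C, -, hb⟩ := hp.exists_norm_sq_sub_le hxs
    refine ⟨C, fun k _ => ?_⟩
    have h1 : 1 - μ / (2 * Ll) = 1 - α * T := by
      rw [hTL, hαeq]
      ring
    rw [h1]
    exact hb k
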